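/- Let $\mathbb{H}$ be the real quaternions, $d\mu_2(x)=dx/(2\pi)$ on $\mathbb{R}^2$ and $d\mu_4=dx/(2\pi)^2$ on $\mathbb{R}^4=\mathbb{R}^2\times\mathbb{R}^2$; all $L^p$ spaces are taken with respect to these measures. For $F,G\in L^2(\mathbb{R}^d,\mathbb{H})$, $d\in\{2,4\}$, put $(F,G)_{L^2(\mathbb{R}^d)}=\mathrm{Sc}\int_{\mathbb{R}^d}F(x)\overline{G(x)}\,d\mu_d(x)$, where $\mathrm{Sc}$ is the real part of a quaternion. For $f\in L^1(\mathbb{R}^2,\mathbb{H})\cap L^2(\mathbb{R}^2,\mathbb{H})$ let $$\mathcal{F}_Q(f)(u,v)=\int_{\mathbb{R}^2}e^{-ixu}f(x,y)e^{-jyv}\,d\mu_2(x,y)$$ be the two-sided quaternion Fourier transform. For $\xi=(\xi_1,\xi_2)\in\mathbb{R}^2$ let $A_\xi=\mathrm{diag}(\xi_1,\xi_2)$, so $\det A_\xi=\xi_1\xi_2$, and write $1-\xi=(1-\xi_1,1-\xi_2)$. A nonzero $\varphi\in L^1(\mathbb{R}^2,\mathbb{H})\cap L^2(\mathbb{R}^2,\mathbb{H})$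 is an admissible window if $$C_\varphi=\int_{\mathbb{R}^2}|\mathcal{F}_Q(\overline{\varphi})(1-\xi)|^2\,\frac{d\mu_2(\xi)}{|\det A_\xi|}$$ is finite and positive. For admissible windows $\varphi,\psi$ put $$C_{\varphi,\psi}=\int_{\mathbb{R}^2}\mathcal{F}_Q(\overline{\varphi})(1-\xi)\,\overline{\mathcal{F}_Q(\overline{\psi})(1-\xi)}\,\frac{d\mu_2(\xi)}{|\det A_\xi|}\in\mathbb{H}.$$ For $f\in L^2(\mathbb{R}^2,\mathbb{H})$ the quaternion Stockwell transform is $$(S_\varphi^Qf)(\xi,b)=|\det A_\xi|^{1/2}\int_{\mathbb{R}^2}e^{-ix_1\xi_1}f(x)e^{-jx_2\xi_2}\,\overline{\varphi(A_\xi(x-b))}\,d\mu_2(x),\qquad \xi,b\in\mathbb{R}^2 .$$ **Theorem.** Let $\varphi,\psi$ be admissible windows such that, for $h=\varphi$ and for $h=\psi$ and all $u,v,y\in\mathbb{R}$, $$\mathcal{F}_Q(h)(u,v)\,e^{-jvy}=e^{-jvy}\,\mathcal{F}_Q(h)(u,v)\quad\text{and}\quad \mathcal{F}_Q(jh)(u,v)\,e^{-jvy}=j\,e^{-jvy}\,\mathcal{F}_Q(h)(u,v).$$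 Then the integral defining $C_{\varphi,\psi}$ converges absolutely, and: 1. (Parseval) For all $f,g\in L^2(\mathbb{R}^2,\mathbb{H})$, the functions $S_\varphi^Qf$ and $S_\psi^Qg$ belong to $L^2(\mathbb{R}^4,\mathbb{H})$ and $$(S_\varphi^Qf,S_\psi^Qg)_{L^2(\mathbb{R}^4)}=(f\,C_{\varphi,\psi},g)_{L^2(\mathbb{R}^2)}.$$ 2. (Plancherel) For every $f\in L^2(\mathbb{R}^2,\mathbb{H})$, $$\int_{\mathbb{R}^2}\int_{\mathbb{R}^2}|S_\varphi^Qf(\xi,b)|^2\,d\mu_2(\xi)\,d\mu_2(b)=C_\varphi\,\|f\|_{L^2(\mathbb{R}^2)}^2 .$$ -/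

import Mathlib

open MeasureTheory
open scoped Quaternion ENNReal

noncomputable section

namespace QStockwell

/-- The normalized Lebesgue measure `dx / (2π)` on `ℝ²`. -/
def mu2 : Measure (ℝ × ℝ) := ENNReal.ofReal ((2 * Real.pi)⁻¹) • volume

/-- The normalized Lebesgue measure `dx / (2π)²` on `ℝ⁴ = ℝ² × ℝ²`. -/
def mu4 : Measure ((ℝ × ℝ) × (ℝ × ℝ)) := ENNReal.ofReal (((2 * Real.pi) ^ 2)⁻¹) • volume

theorem mu4_eq_prod : mu4 = mu2.prod mu2 := by
  unfold mu4 mu2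
  rw [Measure.prod_smul_left, Measure.prod_smul_right, smul_smul,
    ← ENNReal.ofReal_mul (by positivity), ← Measure.volume_eq_prod]
  congr 2
  rw [sq, mul_inv]

/-- The quaternion unit `i`. -/
def qi : ℍ[ℝ] := ⟨0, 1, 0, 0⟩

/-- The quaternion unit `j`. -/
def qj : ℍ[ℝ] := ⟨0, 0, 1, 0⟩

/-- `exp (i t) = cos t + i sin t`. -/
def expI (t : ℝ) : ℍ[ℝ] := ⟨Real.cos t, Real.sin t, 0, 0⟩

/-- `exp (j t) = cos t + j sin t`. -/
def expJ (t : ℝ) : ℍ[ℝ] := ⟨Real.cos t, 0, Real.sin t, 0⟩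

theorem exp_smul_of_sq (q : ℍ[ℝ]) (hre : q.re = 0) (hn : ‖q‖ = 1) (t : ℝ) :
    NormedSpace.exp (t • q) = (Real.cos t : ℍ[ℝ]) + Real.sin t • q := by
  have h0 : (t • q).re = 0 := by simp [hre]
  rw [Quaternion.exp_of_re_eq_zero _ h0, norm_smul, hn, mul_one, Real.norm_eq_abs, Real.cos_abs,
    smul_smul]
  congr 2
  rcases eq_or_ne t 0 with rfl | ht
  · simp
  · rcases abs_choice t with h | h <;> rw [h] <;> simp [ht]

theorem expI_eq_exp (t : ℝ) : expI t = NormedSpace.exp (t • qi) := by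
  rw [exp_smul_of_sq qi rfl (by
    rw [← sq_eq_sq₀ (norm_nonneg _) zero_le_one, sq, ← Quaternion.normSq_eq_norm_mul_self]
    rw [Quaternion.normSq_def']; norm_num [qi])]
  ext <;> simp only [expI, Quaternion.re_add, Quaternion.imI_add, Quaternion.imJ_add,
    Quaternion.imK_add, Quaternion.re_smul, Quaternion.imI_smul, Quaternion.imJ_smul,
    Quaternion.imK_smul, Quaternion.re_coe, Quaternion.imI_coe, Quaternion.imJ_coe,
    Quaternion.imK_coe] <;> simp [qi]

theorem expJ_eq_exp (t : ℝ) : expJ t = NormedSpace.exp (t • qj) := by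
  rw [exp_smul_of_sq qj rfl (by
    rw [← sq_eq_sq₀ (norm_nonneg _) zero_le_one, sq, ← Quaternion.normSq_eq_norm_mul_self]
    rw [Quaternion.normSq_def']; norm_num [qj])]
  ext <;> simp only [expJ, Quaternion.re_add, Quaternion.imI_add, Quaternion.imJ_add,
    Quaternion.imK_add, Quaternion.re_smul, Quaternion.imI_smul, Quaternion.imJ_smul,
    Quaternion.imK_smul, Quaternion.re_coe, Quaternion.imI_coe, Quaternion.imJ_coe,
    Quaternion.imK_coe] <;> simp [qj]

/-- The quaternion-valued inner product `⟨F, G⟩ = ∫ F conj(G) dμ`. -/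
def qInner {X : Type*} [MeasurableSpace X] (μ : Measure X) (F G : X → ℍ[ℝ]) : ℍ[ℝ] :=
  ∫ x, F x * star (G x) ∂μ

/-- The scalar part `(F, G) = Sc ⟨F, G⟩` of the quaternion-valued inner product. -/
def scInner {X : Type*} [MeasurableSpace X] (μ : Measure X) (F G : X → ℍ[ℝ]) : ℝ :=
  (qInner μ F G).re

/-- The two-sided quaternion Fourier transform (given by its integral, for integrable `f`):
`F_Q f (u, v) = ∫ exp(-i x u) f(x, y) exp(-j y v) dμ₂(x, y)`. -/
def qft (f : ℝ × ℝ → ℍ[ℝ]) (w : ℝ × ℝ) : ℍ[ℝ] :=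
  ∫ x, expI (-(x.1 * w.1)) * f x * expJ (-(x.2 * w.2)) ∂mu2

/-- The commutation hypothesis of the convolution theorem for the two-sided transform. -/
def CommutationHyp (g : ℝ × ℝ → ℍ[ℝ]) : Prop :=
  ∀ u v y : ℝ,
    qft g (u, v) * expJ (-(v * y)) = expJ (-(v * y)) * qft g (u, v) ∧
    qft (fun x => qj * g x) (u, v) * expJ (-(v * y)) = qj * expJ (-(v * y)) * qft g (u, v)

/-- The diagonal matrix `A_ξ = diag(ξ₁, ξ₂)` acting on `x`. -/
def applyA (ξ x : ℝ × ℝ) : ℝ × ℝ := (ξ.1 * x.1, ξ.2 * x.2)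

/-- `det A_ξ = ξ₁ ξ₂`. -/
def detA (ξ : ℝ × ℝ) : ℝ := ξ.1 * ξ.2

/-- The integrand of the admissibility constant `C_φ`; here `1 - ξ = (1 - ξ₁, 1 - ξ₂)`. -/
def admIntegrand (φ : ℝ × ℝ → ℍ[ℝ]) (ξ : ℝ × ℝ) : ℝ :=
  ‖qft (fun x => star (φ x)) (1 - ξ.1, 1 - ξ.2)‖ ^ 2 / |detA ξ|

/-- The admissibility constant `C_φ`. -/
def admConst (φ : ℝ × ℝ → ℍ[ℝ]) : ℝ := ∫ ξ, admIntegrand φ ξ ∂mu2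

/-- The integrand of the constant `C_{φ,ψ}`. -/
def pairIntegrand (φ ψ : ℝ × ℝ → ℍ[ℝ]) (ξ : ℝ × ℝ) : ℍ[ℝ] :=
  |detA ξ|⁻¹ • (qft (fun x => star (φ x)) (1 - ξ.1, 1 - ξ.2) *
    star (qft (fun x => star (ψ x)) (1 - ξ.1, 1 - ξ.2)))

/-- The quaternion constant `C_{φ,ψ}`. -/
def pairConst (φ ψ : ℝ × ℝ → ℍ[ℝ]) : ℍ[ℝ] := ∫ ξ, pairIntegrand φ ψ ξ ∂mu2

/-- Admissible quaternion windows: nonzero functions in `L¹ ∩ L²` for which the integral `C_φ`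
converges to a positive real number. -/
structure IsAdmissibleWindow (φ : ℝ × ℝ → ℍ[ℝ]) : Prop where
  memLp_one : MemLp φ 1 mu2
  memLp_two : MemLp φ 2 mu2
  ne_zero : ¬ φ =ᵐ[mu2] 0
  integrable : Integrable (admIntegrand φ) mu2
  pos : 0 < admConst φ

/-- The two-dimensional continuous quaternion Stockwell transform `(S_φ f)(ξ, b)`. -/
def stockwell (φ f : ℝ × ℝ → ℍ[ℝ]) (ξ b : ℝ × ℝ) : ℍ[ℝ] :=
  Real.sqrt |detA ξ| •
    ∫ x, expI (-(x.1 * ξ.1)) * f x * expJ (-(x.2 * ξ.2)) * star (φ (applyA ξ (x - b))) ∂mu2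

/-- The Stockwell transform as a function on `ℝ⁴ = ℝ² × ℝ²`. -/
def stockwell4 (φ f : ℝ × ℝ → ℍ[ℝ]) (p : (ℝ × ℝ) × (ℝ × ℝ)) : ℍ[ℝ] :=
  stockwell φ f p.1 p.2

end QStockwell

end

/-! The proof reduces the quaternion statement to a complex one. Let ℂ sit in ℍ as ℝ + ℝj and split
ℍ = (1 + k)ℂ ⊕ (1 - k)ℂ. Right multiplication by ℝ + ℝj is complex multiplication on both summands,
while left multiplication by e^{it} is multiplication by e^{-jt} on the first and e^{jt} on the
second. So the two-sided transform is a pair of ordinary Fourier transforms, one of them with the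
first frequency reflected (`qft_eq_cft`).

The commutation hypotheses are rigid. Taking y = 0 makes the transform of a window even in u, and
choosing e^{-jvy} = j makes it commute with j wherever v ≠ 0. By injectivity of the Fourier
transform the window is a.e. (ℝ + ℝj)-valued and even in its first variable
(`CommutationHyp.isEvenWindow`). Evenness absorbs the reflection, so the quaternion Stockwell
transform becomes two complex ones with the same complex window, applied to the two coordinates of f
(`IsEvenWindow.stockwell_eq`).

In the complex case, for fixed ξ the transform is, up to a phase, a reflection and the factor |det
A_ξ|^{-1/2}, the Fourier transform in b of η ↦ f̂(η) · F(conj φ)(1 - η/ξ) (`cst_eq_cft_spec`).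
Plancherel in b and Fubini leave an inner integral in ξ against dξ/|det A_ξ|. That measure is
invariant under ξ ↦ η/ξ (`measurePreserving_divA`), so the inner integral is a constant independent
of η. The two halves recombine because (1 + k)ℂ and (1 - k)ℂ are orthogonal (`re_emb_mul_star`).
Plancherel is the case φ = ψ, f = g. -/

noncomputable section

namespace QStockwell

open scoped FourierTransform ComplexConjugate SchwartzMap ContDiff
open WithLp (toLp ofLp)

/-! ### Fourier transform on L²(ℝ², dx/2π) -/

/-- The `L²` Fourier transform agrees with the Fourier integral on `L¹ ∩ L²`. -/
theorem coeFn_fourier_toLp {V : Type*} [NormedAddCommGroup V] [InnerProductSpace ℝ V]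
    [FiniteDimensional ℝ V] [MeasurableSpace V] [BorelSpace V] {f : V → ℂ}
    (h1 : Integrable f) (h2 : MemLp f 2) :
    (𝓕 (h2.toLp f) : Lp ℂ 2 (volume : Measure V)) =ᵐ[volume] 𝓕 f := by
  have hcont : Continuous (𝓕 f) :=
    VectorFourier.fourierIntegral_continuous Real.continuous_fourierChar
      (by exact continuous_inner) h1
  apply ae_eq_of_integral_contDiff_smul_eq
  · exact (Lp.memLp _).locallyIntegrable (by norm_num)
  · exact hcont.locallyIntegrable
  · intro g g_smooth g_cpt
    have hg₁ : HasCompactSupport (Complex.ofRealCLM ∘ g) := g_cpt.comp_left rfl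
    have hg₂ : ContDiff ℝ ∞ (Complex.ofRealCLM ∘ g) := by fun_prop
    set G : 𝓢(V, ℂ) := hg₁.toSchwartzMap hg₂ with hG
    have hGa : ∀ x, G x = (g x : ℂ) := fun x => rfl
    -- Both sides are tested on G: the L² transform is the distributional one, so the Fourier
    -- operator moves onto G and then back onto f by self-adjointness of the Fourier integral.
    have key := congrArg (fun T => T G) (Lp.fourier_toTemperedDistribution_eq (h2.toLp f))
    simp only [TemperedDistribution.fourier_apply, Lp.toTemperedDistribution_apply] at key
    have e1 : ∫ x, g x • (𝓕 (h2.toLp f) : Lp ℂ 2 (volume : Measure V)) x =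
        ∫ x, G x • (𝓕 (h2.toLp f) : Lp ℂ 2 (volume : Measure V)) x := by
      refine integral_congr_ae (.of_forall fun x => ?_)
      simp [hGa]
    rw [e1, ← key]
    have e2 : ∫ x, (𝓕 G) x • (h2.toLp f : Lp ℂ 2 (volume : Measure V)) x =
        ∫ x, (𝓕 (G : V → ℂ)) x • f x := by
      refine integral_congr_ae ?_
      filter_upwards [h2.coeFn_toLp] with x hx
      rw [hx, SchwartzMap.fourier_coe]
    rw [e2]
    have e3 := VectorFourier.integral_fourierIntegral_smul_eq_flip (μ := (volume : Measure V))
      (ν := (volume : Measure V)) (L := innerₗ V) Real.continuous_fourierChar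
      (by exact continuous_inner) G.integrable h1
    rw [flip_innerₗ] at e3
    refine e3.trans (integral_congr_ae (.of_forall fun x => ?_))
    simp only [hGa]
    simp only [Complex.real_smul, smul_eq_mul]
    rfl

/-- The complex Fourier transform on `ℝ²`, normalized with respect to `mu2`. -/
def cft (h : ℝ × ℝ → ℂ) (w : ℝ × ℝ) : ℂ :=
  ∫ x, Complex.exp (-((x.1 * w.1 + x.2 * w.2 : ℝ) * Complex.I)) * h x ∂mu2

/-- The Euclidean plane with its `L²` norm. -/
abbrev Plane : Type := WithLp 2 (ℝ × ℝ)

/-- The rescaling that turns the Mathlib Fourier transform into `cft`. -/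
def rescale (w : ℝ × ℝ) : Plane := toLp 2 ((2 * Real.pi)⁻¹ • w)

theorem measurePreserving_ofLp :
    MeasurePreserving (ofLp : Plane → ℝ × ℝ) (ENNReal.ofReal ((2 * Real.pi)⁻¹) • volume) mu2 :=
  (WithLp.volume_preserving_ofLp ℝ ℝ).smul_measure _

/-- The kernel e^{-2πi⟨x,w⟩} forces the frequency w/2π. Its Jacobian (2π)² in the plane, against the
density 1/2π of `mu2`, leaves the factor 2π. -/
theorem measurePreserving_rescale :
    MeasurePreserving rescale mu2 (ENNReal.ofReal (2 * Real.pi) • volume) := by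
  have hpi := Real.pi_pos
  have h1 : MeasurePreserving (fun w : ℝ × ℝ => (2 * Real.pi)⁻¹ • w) mu2
      (ENNReal.ofReal (2 * Real.pi) • volume) := by
    refine ⟨by fun_prop, ?_⟩
    rw [mu2, Measure.map_smul, Measure.map_addHaar_smul _ (by positivity), smul_smul,
      ← ENNReal.ofReal_mul (by positivity)]
    congr 2
    rw [Module.finrank_prod, Module.finrank_self, abs_of_pos (by positivity), one_add_one_eq_two]
    field_simp
  exact ((WithLp.volume_preserving_toLp ℝ ℝ).smul_measure _).comp h1

theorem memLp_comp_ofLp {f : ℝ × ℝ → ℂ} {p : ℝ≥0∞} (hf : MemLp f p mu2) :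
    MemLp (fun x : Plane => f (ofLp x)) p := by
  have h := (hf.comp_measurePreserving measurePreserving_ofLp).smul_measure
    (c := ENNReal.ofReal (2 * Real.pi)) ENNReal.ofReal_ne_top
  rwa [smul_smul, ← ENNReal.ofReal_mul (by positivity), mul_inv_cancel₀ (by positivity),
    ENNReal.ofReal_one, one_smul] at h

theorem integral_comp_ofLp (f : ℝ × ℝ → ℂ) :
    ∫ x : Plane, f (ofLp x) = ((2 * Real.pi : ℝ) : ℂ) * ∫ x, f x ∂mu2 := by
  have h := (WithLp.volume_preserving_ofLp ℝ ℝ).integral_comp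
    (MeasurableEquiv.toLp 2 (ℝ × ℝ)).symm.measurableEmbedding f
  refine h.trans ?_
  rw [mu2, integral_smul_measure, ENNReal.toReal_ofReal (by positivity), Complex.real_smul,
    ← mul_assoc, ← Complex.ofReal_mul, mul_inv_cancel₀ (by positivity)]
  simp

theorem cft_eq_fourier (h : ℝ × ℝ → ℂ) (w : ℝ × ℝ) :
    cft h w = ((2 * Real.pi : ℝ) : ℂ)⁻¹ * 𝓕 (fun x : Plane => h (ofLp x)) (rescale w) := by
  have hpi : ((2 * Real.pi : ℝ) : ℂ) ≠ 0 := by exact_mod_cast (by positivity)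
  rw [Real.fourier_eq', eq_inv_mul_iff_mul_eq₀ hpi, cft, ← integral_comp_ofLp]
  congr 1
  ext x
  simp only [rescale, WithLp.prod_inner_apply, smul_eq_mul]
  congr 2
  simp
  field_simp

open Classical in
/-- The complex Fourier transform of an `L²` function. -/
def cft2 (f : ℝ × ℝ → ℂ) (w : ℝ × ℝ) : ℂ :=
  if hf : MemLp f 2 mu2 then
    ((2 * Real.pi : ℝ) : ℂ)⁻¹ *
      (𝓕 ((memLp_comp_ofLp hf).toLp (fun x : Plane => f (ofLp x))) :
        Lp ℂ 2 (volume : Measure Plane))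
        (rescale w)
  else 0

theorem memLp_cft2 {f : ℝ × ℝ → ℂ} (hf : MemLp f 2 mu2) : MemLp (cft2 f) 2 mu2 := by
  unfold cft2
  simp only [hf, dif_pos]
  refine MemLp.const_mul ?_ _
  exact ((Lp.memLp _).smul_measure ENNReal.ofReal_ne_top).comp_measurePreserving
    measurePreserving_rescale

theorem cft2_ae_eq {f : ℝ × ℝ → ℂ} (h1 : MemLp f 1 mu2) (hf : MemLp f 2 mu2) :
    cft2 f =ᵐ[mu2] cft f := by
  have := measurePreserving_rescale.quasiMeasurePreserving.ae_eq_comp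
    ((Measure.smul_absolutelyContinuous (c := ENNReal.ofReal (2 * Real.pi))).ae_eq
      (coeFn_fourier_toLp (memLp_one_iff_integrable.1 (memLp_comp_ofLp h1)) (memLp_comp_ofLp hf)))
  filter_upwards [this] with w hw
  simp only [cft2, hf, dif_pos, cft_eq_fourier]
  congr 1

theorem integral_cft2_mul_conj {f g : ℝ × ℝ → ℂ} (hf : MemLp f 2 mu2) (hg : MemLp g 2 mu2) :
    ∫ w, cft2 f w * conj (cft2 g w) ∂mu2 = ∫ x, f x * conj (g x) ∂mu2 := by
  have hpi : ((2 * Real.pi : ℝ) : ℂ) ≠ 0 := by exact_mod_cast (by positivity)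
  have h := Lp.inner_fourier_eq ((memLp_comp_ofLp hg).toLp _) ((memLp_comp_ofLp hf).toLp _)
  rw [L2.inner_def, L2.inner_def] at h
  have e1 : ∫ a : Plane, inner ℂ ((memLp_comp_ofLp hg).toLp _ a) ((memLp_comp_ofLp hf).toLp _ a) =
      ∫ a : Plane, f (ofLp a) * conj (g (ofLp a)) := by
    refine integral_congr_ae ?_
    filter_upwards [(memLp_comp_ofLp hg).coeFn_toLp, (memLp_comp_ofLp hf).coeFn_toLp] with x h1 h2
    rw [h1, h2]
    simp
  rw [e1, integral_comp_ofLp (fun x => f x * conj (g x))] at h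
  have hemb : MeasurableEmbedding rescale :=
    ((Homeomorph.smulOfNeZero ((2 * Real.pi)⁻¹ : ℝ) (by positivity)).toMeasurableEquiv.trans
      (MeasurableEquiv.toLp 2 (ℝ × ℝ))).measurableEmbedding
  have e2 := measurePreserving_rescale.integral_comp hemb (fun x => inner ℂ
    ((𝓕 ((memLp_comp_ofLp hg).toLp (fun x : Plane => g (ofLp x))) :
      Lp ℂ 2 (volume : Measure Plane)) x)
    ((𝓕 ((memLp_comp_ofLp hf).toLp (fun x : Plane => f (ofLp x))) :
      Lp ℂ 2 (volume : Measure Plane)) x))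
  rw [integral_smul_measure, h, ENNReal.toReal_ofReal (by positivity), Complex.real_smul,
    ← mul_assoc] at e2
  -- The two prefactors 1/2π in `cft2` cancel one factor 2π from `rescale` and one from passing
  -- between `volume` and `mu2`.
  rw [← mul_right_inj' (mul_ne_zero hpi hpi), ← e2, ← integral_const_mul]
  refine integral_congr_ae (.of_forall fun w => ?_)
  simp only [cft2, hf, hg, dif_pos, map_mul, map_inv₀, Complex.conj_ofReal]
  field_simp
  simp

theorem continuous_cft {h : ℝ × ℝ → ℂ} (h1 : MemLp h 1 mu2) : Continuous (cft h) := by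
  have hc : Continuous (𝓕 (fun x : Plane => h (ofLp x))) :=
    VectorFourier.fourierIntegral_continuous Real.continuous_fourierChar
      (by exact continuous_inner) (memLp_one_iff_integrable.1 (memLp_comp_ofLp h1))
  have hr : Continuous rescale := by unfold rescale; fun_prop
  rw [show cft h = _ from funext (cft_eq_fourier h)]
  exact continuous_const.mul (hc.comp hr)

theorem norm_cft_le (h : ℝ × ℝ → ℂ) (w : ℝ × ℝ) : ‖cft h w‖ ≤ ∫ x, ‖h x‖ ∂mu2 := by
  refine (norm_integral_le_integral_norm _).trans_eq (integral_congr_ae (.of_forall fun x => ?_))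
  simp only [norm_mul, ← neg_mul, ← Complex.ofReal_neg, Complex.norm_exp_ofReal_mul_I, one_mul]

theorem memLp_cft {f : ℝ × ℝ → ℂ} (h1 : MemLp f 1 mu2) (hf : MemLp f 2 mu2) :
    MemLp (cft f) 2 mu2 :=
  (memLp_congr_ae (cft2_ae_eq h1 hf)).1 (memLp_cft2 hf)

theorem integral_cft_mul_conj {f g : ℝ × ℝ → ℂ} (hf1 : MemLp f 1 mu2) (hf : MemLp f 2 mu2)
    (hg1 : MemLp g 1 mu2) (hg : MemLp g 2 mu2) :
    ∫ w, cft f w * conj (cft g w) ∂mu2 = ∫ x, f x * conj (g x) ∂mu2 := by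
  rw [← integral_cft2_mul_conj hf hg]
  refine integral_congr_ae ?_
  filter_upwards [cft2_ae_eq hf1 hf, cft2_ae_eq hg1 hg] with x h1 h2
  rw [h1, h2]

theorem integral_mul_conj_eq_cft2_cft {f g : ℝ × ℝ → ℂ} (hf : MemLp f 2 mu2)
    (hg1 : MemLp g 1 mu2) (hg : MemLp g 2 mu2) :
    ∫ x, f x * conj (g x) ∂mu2 = ∫ w, cft2 f w * conj (cft g w) ∂mu2 := by
  rw [← integral_cft2_mul_conj hf hg]
  refine integral_congr_ae ?_
  filter_upwards [cft2_ae_eq hg1 hg] with x h2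
  rw [h2]

/-- Injectivity by Plancherel: the difference has vanishing transform, hence zero L² norm. -/
theorem ae_eq_of_cft_ae_eq {f g : ℝ × ℝ → ℂ} (hf1 : MemLp f 1 mu2) (hf : MemLp f 2 mu2)
    (hg1 : MemLp g 1 mu2) (hg : MemLp g 2 mu2) (h : cft f =ᵐ[mu2] cft g) : f =ᵐ[mu2] g := by
  have hs1 := hf1.sub hg1
  have hs := hf.sub hg
  have hz : cft (f - g) =ᵐ[mu2] 0 := by
    filter_upwards [h] with w hw
    have hint : ∀ {k : ℝ × ℝ → ℂ}, MemLp k 1 mu2 → Integrable (fun x : ℝ × ℝ =>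
        Complex.exp (-((x.1 * w.1 + x.2 * w.2 : ℝ) * Complex.I)) * k x) mu2 := by
      intro k hk
      refine (memLp_one_iff_integrable.1 hk).bdd_mul (c := 1) (by fun_prop) (.of_forall fun x => ?_)
      rw [← neg_mul, ← Complex.ofReal_neg, Complex.norm_exp_ofReal_mul_I]
    simp only [cft, Pi.sub_apply, mul_sub, Pi.zero_apply]
    rw [integral_sub (hint hf1) (hint hg1)]
    exact sub_eq_zero.2 hw
  have h0 := integral_cft_mul_conj hs1 hs hs1 hs
  rw [integral_congr_ae (g := fun _ => (0 : ℂ)) (by filter_upwards [hz] with w hw; simp [hw]),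
    integral_zero] at h0
  have e : ∀ x, (f - g) x * conj ((f - g) x) = ((‖(f - g) x‖ ^ 2 : ℝ) : ℂ) := by
    intro x; rw [Complex.mul_conj, Complex.normSq_eq_norm_sq]
  simp only [e, integral_complex_ofReal] at h0
  have h0' := Complex.ofReal_eq_zero.1 h0.symm
  rw [integral_eq_zero_iff_of_nonneg (fun x => by positivity)
    ((memLp_two_iff_integrable_sq_norm hs.1).1 hs)] at h0'
  filter_upwards [h0'] with x hx
  have : ‖f x - g x‖ = 0 := by simpa using hx
  exact sub_eq_zero.1 (norm_eq_zero.1 this)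

/-! ### Anisotropic dilations, characters and atoms -/

instance isAddHaarMeasure_mu2 : mu2.IsAddHaarMeasure := by
  unfold mu2
  exact Measure.IsAddHaarMeasure.smul _ (by simp [Real.pi_pos]) ENNReal.ofReal_ne_top

theorem detA_ne_zero {ξ : ℝ × ℝ} : detA ξ ≠ 0 ↔ ξ.1 ≠ 0 ∧ ξ.2 ≠ 0 := mul_ne_zero_iff

theorem ae_detA_ne_zero : ∀ᵐ ξ ∂mu2, detA ξ ≠ 0 := by
  have h : ∀ᵐ ξ : ℝ × ℝ ∂(volume : Measure (ℝ × ℝ)), detA ξ ≠ 0 := by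
    rw [Measure.volume_eq_prod]
    simp_rw [detA_ne_zero]
    have h0 : ∀ᵐ x : ℝ, x ≠ 0 := by simp [ae_iff]
    exact (Measure.quasiMeasurePreserving_fst.ae h0).and (Measure.quasiMeasurePreserving_snd.ae h0)
  exact (Measure.smul_absolutelyContinuous (c := ENNReal.ofReal ((2 * Real.pi)⁻¹))).ae_le h

theorem measurePreserving_applyA {ξ : ℝ × ℝ} (hξ : detA ξ ≠ 0) :
    MeasurePreserving (applyA ξ) mu2 (ENNReal.ofReal |detA ξ|⁻¹ • mu2) := by
  obtain ⟨h1, h2⟩ := detA_ne_zero.1 hξ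
  refine ⟨by unfold applyA; fun_prop, ?_⟩
  have e : applyA ξ = Prod.map (fun x => ξ.1 * x) (fun x => ξ.2 * x) := rfl
  rw [mu2, Measure.map_smul, smul_comm, e, Measure.volume_eq_prod, ← Measure.map_prod_map _ _
    (by fun_prop) (by fun_prop), Real.map_volume_mul_left h1, Real.map_volume_mul_left h2,
    Measure.prod_smul_left, Measure.prod_smul_right, smul_smul (ENNReal.ofReal |ξ.1⁻¹|),
    ← ENNReal.ofReal_mul (abs_nonneg _),
    ← abs_mul, detA, ← mul_inv, abs_inv]

theorem measurableEmbedding_applyA {ξ : ℝ × ℝ} (hξ : detA ξ ≠ 0) :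
    MeasurableEmbedding (applyA ξ) := by
  obtain ⟨h1, h2⟩ := detA_ne_zero.1 hξ
  exact ((Homeomorph.mulLeft₀ ξ.1 h1).prodCongr (Homeomorph.mulLeft₀ ξ.2 h2)).measurableEmbedding

theorem measurePreserving_applyA_sub {ξ : ℝ × ℝ} (hξ : detA ξ ≠ 0) (b : ℝ × ℝ) :
    MeasurePreserving (fun x => applyA ξ (x - b)) mu2 (ENNReal.ofReal |detA ξ|⁻¹ • mu2) :=
  (measurePreserving_applyA hξ).comp (measurePreserving_sub_right mu2 b)

theorem memLp_comp_applyA_sub {E : Type*} [NormedAddCommGroup E] {g : ℝ × ℝ → E} {p : ℝ≥0∞}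
    (hg : MemLp g p mu2) {ξ : ℝ × ℝ} (hξ : detA ξ ≠ 0) (b : ℝ × ℝ) :
    MemLp (fun x => g (applyA ξ (x - b))) p mu2 :=
  (hg.smul_measure ENNReal.ofReal_ne_top).comp_measurePreserving (measurePreserving_applyA_sub hξ b)

theorem integral_comp_applyA_sub {E : Type*} [NormedAddCommGroup E] [NormedSpace ℝ E]
    (g : ℝ × ℝ → E) {ξ : ℝ × ℝ} (hξ : detA ξ ≠ 0) (b : ℝ × ℝ) :
    ∫ x, g (applyA ξ (x - b)) ∂mu2 = |detA ξ|⁻¹ • ∫ x, g x ∂mu2 := by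
  have h := (measurePreserving_applyA_sub hξ b).integral_comp
    ((measurableEmbedding_applyA hξ).comp (measurableEmbedding_subRight b)) g
  rw [integral_smul_measure, ENNReal.toReal_ofReal (by positivity)] at h
  exact h

/-- The coordinatewise quotient `η / ξ`. -/
def divA (η ξ : ℝ × ℝ) : ℝ × ℝ := (η.1 / ξ.1, η.2 / ξ.2)

theorem measurable_divA : Measurable (fun p : (ℝ × ℝ) × (ℝ × ℝ) => divA p.1 p.2) := by
  unfold divA; fun_prop

/-- The complex exponential `exp (i x · ξ)`. -/
def expDot (x ξ : ℝ × ℝ) : ℂ := Complex.exp ((x.1 * ξ.1 + x.2 * ξ.2 : ℝ) * Complex.I)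

theorem norm_expDot (x ξ : ℝ × ℝ) : ‖expDot x ξ‖ = 1 := Complex.norm_exp_ofReal_mul_I _

theorem conj_expDot (x ξ : ℝ × ℝ) : conj (expDot x ξ) = expDot x (-ξ) := by
  simp only [expDot, ← Complex.exp_conj, map_mul, Complex.conj_ofReal, Complex.conj_I]
  congr 1
  push_cast [Prod.fst_neg, Prod.snd_neg]
  ring

theorem continuous_expDot : Continuous (fun p : (ℝ × ℝ) × (ℝ × ℝ) => expDot p.1 p.2) := by
  unfold expDot; fun_prop

theorem cft_eq_expDot (h : ℝ × ℝ → ℂ) (w : ℝ × ℝ) :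
    cft h w = ∫ x, expDot x (-w) * h x ∂mu2 := by
  unfold cft expDot
  refine integral_congr_ae (.of_forall fun x => ?_)
  simp only
  congr 2
  push_cast [Prod.fst_neg, Prod.snd_neg]
  ring

theorem expDot_add_right (x ξ η : ℝ × ℝ) : expDot x (ξ + η) = expDot x ξ * expDot x η := by
  simp only [expDot, ← Complex.exp_add]
  congr 1
  push_cast [Prod.fst_add, Prod.snd_add]
  ring

theorem expDot_add_left (x y ξ : ℝ × ℝ) : expDot (x + y) ξ = expDot x ξ * expDot y ξ := by
  simp only [expDot, ← Complex.exp_add]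
  congr 1
  push_cast [Prod.fst_add, Prod.snd_add]
  ring

theorem cft_conj (h : ℝ × ℝ → ℂ) (w : ℝ × ℝ) :
    cft (fun x => conj (h x)) w = conj (cft h (-w)) := by
  rw [cft_eq_expDot, cft_eq_expDot, ← integral_conj]
  simp only [map_mul, conj_expDot, neg_neg]

/-- The modulated dilated translate of a window. -/
def atom (φ : ℝ × ℝ → ℂ) (ξ b x : ℝ × ℝ) : ℂ := expDot x ξ * φ (applyA ξ (x - b))

theorem memLp_expDot_mul {φ : ℝ × ℝ → ℂ} {p : ℝ≥0∞} (hφ : MemLp φ p mu2) (ξ : ℝ × ℝ) :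
    MemLp (fun x => expDot x ξ * φ x) p mu2 := by
  refine hφ.of_le ?_ (.of_forall fun x => ?_)
  · refine AEStronglyMeasurable.mul ?_ hφ.1
    exact (continuous_expDot.comp
      (by fun_prop : Continuous fun x : ℝ × ℝ => (x, ξ))).aestronglyMeasurable
  · simp [norm_expDot]

theorem memLp_atom {φ : ℝ × ℝ → ℂ} {p : ℝ≥0∞} (hφ : MemLp φ p mu2) {ξ : ℝ × ℝ}
    (hξ : detA ξ ≠ 0) (b : ℝ × ℝ) : MemLp (atom φ ξ b) p mu2 :=
  memLp_expDot_mul (memLp_comp_applyA_sub hφ hξ b) ξ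

theorem cft_atom (φ : ℝ × ℝ → ℂ) {ξ : ℝ × ℝ} (hξ : detA ξ ≠ 0) (b η : ℝ × ℝ) :
    cft (atom φ ξ b) η =
      |detA ξ|⁻¹ • (expDot b (ξ - η) * cft φ (divA (η - ξ) ξ)) := by
  obtain ⟨h1, h2⟩ := detA_ne_zero.1 hξ
  rw [cft_eq_expDot, cft_eq_expDot, ← integral_const_mul, ← integral_comp_applyA_sub _ hξ b]
  refine integral_congr_ae (.of_forall fun x => ?_)
  simp only [atom]
  rw [← mul_assoc, ← mul_assoc, ← expDot_add_right]
  congr 1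
  have e : expDot (applyA ξ (x - b)) (-divA (η - ξ) ξ) = expDot (x - b) (ξ - η) := by
    simp only [expDot, applyA, divA, Prod.fst_neg, Prod.snd_neg, Prod.fst_sub, Prod.snd_sub]
    congr 3
    field_simp
    ring
  rw [e, ← expDot_add_left, add_sub_cancel, neg_add_eq_sub]

/-! ### The complex Stockwell transform at a fixed frequency -/

/-- The complex Stockwell transform. -/
def cst (φ f : ℝ × ℝ → ℂ) (ξ b : ℝ × ℝ) : ℂ :=
  Real.sqrt |detA ξ| • ∫ x, f x * conj (atom φ ξ b x) ∂mu2

/-- The spectral density of the complex Stockwell transform at a fixed frequency. -/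
def spec (φ f : ℝ × ℝ → ℂ) (ξ η : ℝ × ℝ) : ℂ :=
  cft2 f η * cft (fun x => conj (φ x)) (1 - divA η ξ)

/-- Parseval in x moves the pairing to the frequency side. The transform of the atom is a phase
times φ̂(η/ξ - 1), whose conjugate is F(conj φ)(1 - η/ξ); the phase splits into e^{-ib·ξ} and the
Fourier kernel in η at -b. -/
theorem cst_eq_cft_spec {φ f : ℝ × ℝ → ℂ} (h1 : MemLp φ 1 mu2) (h2 : MemLp φ 2 mu2)
    (hf : MemLp f 2 mu2) {ξ : ℝ × ℝ} (hξ : detA ξ ≠ 0) (b : ℝ × ℝ) :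
    cst φ f ξ b = (Real.sqrt |detA ξ|)⁻¹ • (expDot b (-ξ) * cft (spec φ f ξ) (-b)) := by
  obtain ⟨hz1, hz2⟩ := detA_ne_zero.1 hξ
  have hs : Real.sqrt |detA ξ| * |detA ξ|⁻¹ = (Real.sqrt |detA ξ|)⁻¹ := by
    have hp : 0 < Real.sqrt |detA ξ| := Real.sqrt_pos.2 (abs_pos.2 hξ)
    nth_rw 2 [← Real.mul_self_sqrt (abs_nonneg (detA ξ))]
    field_simp
  rw [cst, integral_mul_conj_eq_cft2_cft hf (memLp_atom h1 hξ b) (memLp_atom h2 hξ b), ← hs,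
    mul_smul, cft_eq_expDot, ← integral_const_mul]
  congr 1
  rw [← integral_smul (|detA ξ|⁻¹)]
  refine integral_congr_ae (.of_forall fun η => ?_)
  simp only [spec]
  rw [cft_atom φ hξ, Complex.real_smul, Complex.real_smul, map_mul, map_mul, Complex.conj_ofReal,
    conj_expDot, cft_conj]
  have e1 : -(1 - divA η ξ) = divA (η - ξ) ξ := by
    ext <;> simp [divA] <;> field_simp
  have e2 : expDot b (-(ξ - η)) = expDot b (-ξ) * expDot η (- -b) := by
    rw [neg_sub, sub_eq_neg_add, expDot_add_right, neg_neg]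
    congr 1
    simp only [expDot, mul_comm]
  rw [e1, e2]
  ring

theorem divA_ne_zero {η ξ : ℝ × ℝ} (h : detA η ≠ 0) (hξ : detA ξ ≠ 0) : detA (divA η ξ) ≠ 0 := by
  rw [detA_ne_zero] at *
  exact ⟨div_ne_zero h.1 hξ.1, div_ne_zero h.2 hξ.2⟩

theorem memLp_comp_one_sub_divA {g : ℝ × ℝ → ℂ} {p : ℝ≥0∞} (hg : MemLp g p mu2) {ξ : ℝ × ℝ}
    (hξ : detA ξ ≠ 0) : MemLp (fun η => g (1 - divA η ξ)) p mu2 := by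
  -- Coordinatewise, 1 - η/ξ = (-1/ξ)(η - ξ), a dilated translate.
  have h := memLp_comp_applyA_sub hg (ξ := divA (-1) ξ)
    (divA_ne_zero (by simp [detA]) hξ) ξ
  obtain ⟨h1, h2⟩ := detA_ne_zero.1 hξ
  convert h using 3 with η
  ext <;> simp [applyA, divA] <;> field_simp <;> ring

theorem memLp_conj {φ : ℝ × ℝ → ℂ} {p : ℝ≥0∞} (h : MemLp φ p mu2) :
    MemLp (fun x => conj (φ x)) p mu2 := h.star

theorem memLp_one_spec {φ f : ℝ × ℝ → ℂ} (h1 : MemLp φ 1 mu2) (h2 : MemLp φ 2 mu2)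
    (hf : MemLp f 2 mu2) {ξ : ℝ × ℝ} (hξ : detA ξ ≠ 0) : MemLp (spec φ f ξ) 1 mu2 :=
  (memLp_comp_one_sub_divA (memLp_cft (memLp_conj h1) (memLp_conj h2)) hξ).mul (memLp_cft2 hf)

/-- An integrable window has a bounded transform, so the product with an L² function stays in L². -/
theorem memLp_two_spec {φ f : ℝ × ℝ → ℂ} (h1 : MemLp φ 1 mu2) (h2 : MemLp φ 2 mu2)
    (hf : MemLp f 2 mu2) {ξ : ℝ × ℝ} (hξ : detA ξ ≠ 0) : MemLp (spec φ f ξ) 2 mu2 := by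
  have hb := (memLp_comp_one_sub_divA (memLp_cft (memLp_conj h1) (memLp_conj h2)) hξ).1
  exact (memLp_top_of_bound hb _ (.of_forall fun η => norm_cft_le _ _)).mul (memLp_cft2 hf)

theorem memLp_cst {φ f : ℝ × ℝ → ℂ} (h1 : MemLp φ 1 mu2) (h2 : MemLp φ 2 mu2)
    (hf : MemLp f 2 mu2) {ξ : ℝ × ℝ} (hξ : detA ξ ≠ 0) : MemLp (cst φ f ξ) 2 mu2 := by
  rw [show cst φ f ξ = _ from funext (cst_eq_cft_spec h1 h2 hf hξ)]
  have h := (memLp_cft (memLp_one_spec h1 h2 hf hξ)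
    (memLp_two_spec h1 h2 hf hξ)).comp_measurePreserving
    (Measure.measurePreserving_neg mu2)
  have h' := memLp_expDot_mul h (-ξ)
  exact h'.const_smul ((Real.sqrt |detA ξ|)⁻¹)

/-- Plancherel in b: the unimodular phase is the same in both factors and cancels, and the two
factors |det A_ξ|^{-1/2} multiply to the weight. -/
theorem integral_cst_mul_conj {φ ψ f g : ℝ × ℝ → ℂ} (hφ1 : MemLp φ 1 mu2) (hφ2 : MemLp φ 2 mu2)
    (hψ1 : MemLp ψ 1 mu2) (hψ2 : MemLp ψ 2 mu2)
    (hf : MemLp f 2 mu2) (hg : MemLp g 2 mu2) {ξ : ℝ × ℝ} (hξ : detA ξ ≠ 0) :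
    ∫ b, cst φ f ξ b * conj (cst ψ g ξ b) ∂mu2 =
      |detA ξ|⁻¹ • ∫ η, spec φ f ξ η * conj (spec ψ g ξ η) ∂mu2 := by
  rw [← integral_cft_mul_conj (memLp_one_spec hφ1 hφ2 hf hξ) (memLp_two_spec hφ1 hφ2 hf hξ)
    (memLp_one_spec hψ1 hψ2 hg hξ) (memLp_two_spec hψ1 hψ2 hg hξ),
    ← integral_neg_eq_self _ mu2, ← integral_smul]
  refine integral_congr_ae (.of_forall fun b => ?_)
  simp only
  rw [cst_eq_cft_spec hφ1 hφ2 hf hξ, cst_eq_cft_spec hψ1 hψ2 hg hξ]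
  have e : expDot (-b) (-ξ) * conj (expDot (-b) (-ξ)) = 1 := by
    rw [Complex.mul_conj, Complex.normSq_eq_norm_sq, norm_expDot]; simp
  have hs : ((Real.sqrt |detA ξ| : ℝ) : ℂ)⁻¹ * ((Real.sqrt |detA ξ| : ℝ) : ℂ)⁻¹ =
      ((|detA ξ|⁻¹ : ℝ) : ℂ) := by
    rw [← mul_inv, ← Complex.ofReal_mul, Real.mul_self_sqrt (abs_nonneg _), Complex.ofReal_inv]
  simp only [Complex.real_smul, map_mul, Complex.conj_ofReal, Complex.ofReal_inv, map_inv₀]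
  rw [← Complex.ofReal_inv |detA ξ|, ← hs, neg_neg]
  linear_combination (((Real.sqrt |detA ξ| : ℝ) : ℂ)⁻¹ * ((Real.sqrt |detA ξ| : ℝ) : ℂ)⁻¹) *
    cft (spec φ f ξ) b * conj (cft (spec ψ g ξ) b) * e

/-! ### The invariant measure dξ/|det A_ξ| -/

/-- The measure `dt / |t|` on the line. -/
def haarMul : Measure ℝ := volume.withDensity (fun t => ENNReal.ofReal |t|⁻¹)

/-- This is Haar measure of the multiplicative group, invariant under inversion and scaling: the
Jacobian |a|/t² times |t/a| is 1/|t|. -/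
theorem measurePreserving_div (a : ℝ) (ha : a ≠ 0) :
    MeasurePreserving (fun t : ℝ => a / t) haarMul haarMul := by
  have hm : Measurable (fun t : ℝ => a / t) := by fun_prop
  refine ⟨hm, Measure.ext fun s hs => ?_⟩
  rw [Measure.map_apply hm hs, haarMul, withDensity_apply _ (hm hs), withDensity_apply _ hs,
    ← lintegral_indicator hs, ← lintegral_indicator (hm hs)]
  -- The origin is removed so that t ↦ a/t is a differentiable bijection; it is a null set.
  have h0 : ({0}ᶜ : Set ℝ) =ᵐ[volume] Set.univ := by
    rw [ae_eq_univ]; simp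
  rw [← setLIntegral_univ, ← setLIntegral_univ (s.indicator _), ← setLIntegral_congr h0,
    ← setLIntegral_congr h0]
  have himg : (fun t : ℝ => a / t) '' {0}ᶜ = {0}ᶜ := by
    ext t
    simp only [Set.mem_image, Set.mem_compl_iff, Set.mem_singleton_iff]
    constructor
    · rintro ⟨x, hx, rfl⟩; exact div_ne_zero ha hx
    · intro ht; exact ⟨a / t, div_ne_zero ha ht, by field_simp⟩
  have key := lintegral_image_eq_lintegral_abs_deriv_mul (f := fun t : ℝ => a / t)
    (f' := fun t => -a / t ^ 2) (s := {0}ᶜ) (measurableSet_singleton 0).compl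
    (fun t ht => by
      have h := ((hasDerivAt_const t a).div (hasDerivAt_id t) ht).hasDerivWithinAt (s := {0}ᶜ)
      refine (h.congr_deriv ?_).congr_of_eventuallyEq (.of_forall fun x => rfl) rfl
      simp)
    (fun x hx y hy hxy => by
      have hx : x ≠ 0 := hx
      have hy : y ≠ 0 := hy
      have hxy : a / x = a / y := hxy
      field_simp at hxy
      exact hxy.symm)
    (s.indicator fun t => ENNReal.ofReal |t|⁻¹)
  rw [himg] at key
  rw [key]
  refine setLIntegral_congr_fun (measurableSet_singleton 0).compl fun t ht => ?_
  have ht : t ≠ 0 := ht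
  by_cases hts : a / t ∈ s
  · rw [Set.indicator_of_mem (by exact hts), Set.indicator_of_mem hts]
    rw [← ENNReal.ofReal_mul (abs_nonneg _)]
    congr 1
    rw [← abs_inv, ← abs_inv, ← abs_mul]
    rw [← abs_neg]
    congr 1
    field_simp
  · rw [Set.indicator_of_notMem (by exact hts), Set.indicator_of_notMem hts, mul_zero]

/-- The measure `dμ₂(ξ) / |det A_ξ|`. -/
def lam : Measure (ℝ × ℝ) := mu2.withDensity (fun ξ => ENNReal.ofReal |detA ξ|⁻¹)

instance sFinite_lam : SFinite lam := by unfold lam; infer_instance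

theorem measurable_detA : Measurable detA := by unfold detA; fun_prop

theorem lam_eq_prod : lam = ENNReal.ofReal ((2 * Real.pi)⁻¹) • haarMul.prod haarMul := by
  rw [lam, mu2, withDensity_smul_measure, haarMul, prod_withDensity (by fun_prop) (by fun_prop),
    ← Measure.volume_eq_prod]
  congr 2
  ext ξ
  rw [← ENNReal.ofReal_mul (by positivity), detA, abs_mul, mul_inv]

instance sFinite_haarMul : SFinite haarMul := by unfold haarMul; infer_instance

theorem measurePreserving_divA {η : ℝ × ℝ} (hη : detA η ≠ 0) :
    MeasurePreserving (divA η) lam lam := by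
  obtain ⟨h1, h2⟩ := detA_ne_zero.1 hη
  rw [lam_eq_prod]
  exact ((measurePreserving_div _ h1).prod (measurePreserving_div _ h2)).smul_measure _

section Density
variable {E : Type*} [NormedAddCommGroup E] [NormedSpace ℝ E]

theorem integrable_lam_iff {g : ℝ × ℝ → E} :
    Integrable g lam ↔ Integrable (fun ξ => |detA ξ|⁻¹ • g ξ) mu2 := by
  have hm : Measurable fun ξ : ℝ × ℝ => ENNReal.ofReal |detA ξ|⁻¹ :=
    (measurable_detA.abs.inv).ennreal_ofReal
  rw [lam, integrable_withDensity_iff_integrable_smul' hm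
    (.of_forall fun _ => ENNReal.ofReal_lt_top)]
  simp only [ENNReal.toReal_ofReal (inv_nonneg.2 (abs_nonneg _))]

theorem integral_lam (g : ℝ × ℝ → E) :
    ∫ ξ, g ξ ∂lam = ∫ ξ, |detA ξ|⁻¹ • g ξ ∂mu2 := by
  have hm : Measurable fun ξ : ℝ × ℝ => ENNReal.ofReal |detA ξ|⁻¹ :=
    (measurable_detA.abs.inv).ennreal_ofReal
  rw [lam, integral_withDensity_eq_integral_toReal_smul hm
    (.of_forall fun _ => ENNReal.ofReal_lt_top)]
  simp only [ENNReal.toReal_ofReal (inv_nonneg.2 (abs_nonneg _))]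

theorem integral_comp_divA {P : ℝ × ℝ → E} (hP : AEStronglyMeasurable P lam) {η : ℝ × ℝ}
    (hη : detA η ≠ 0) : ∫ ξ, P (divA η ξ) ∂lam = ∫ ξ, P ξ ∂lam := by
  have h := measurePreserving_divA hη
  rw [← integral_map h.measurable.aemeasurable (by rwa [h.map_eq]), h.map_eq]

end Density

/-! ### Complex Parseval identity -/

/-- The Fourier transform of the conjugate window, evaluated at `1 - ξ`. -/
def winFt (φ : ℝ × ℝ → ℂ) (ξ : ℝ × ℝ) : ℂ := cft (fun x => conj (φ x)) (1 - ξ)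

theorem continuous_winFt {φ : ℝ × ℝ → ℂ} (h1 : MemLp φ 1 mu2) : Continuous (winFt φ) :=
  (continuous_cft (memLp_conj h1)).comp (by fun_prop)

/-- The square-integrable windows whose admissibility integral converges. -/
structure IsWin (φ : ℝ × ℝ → ℂ) : Prop where
  one : MemLp φ 1 mu2
  two : MemLp φ 2 mu2
  win : MemLp (winFt φ) 2 lam

theorem aestronglyMeasurable_spec {φ f : ℝ × ℝ → ℂ} (hφ : IsWin φ) (hf : MemLp f 2 mu2) :
    AEStronglyMeasurable (fun p : (ℝ × ℝ) × (ℝ × ℝ) => spec φ f p.1 p.2) (lam.prod mu2) := by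
  have h2 : Measurable fun p : (ℝ × ℝ) × (ℝ × ℝ) => winFt φ (divA p.2 p.1) :=
    (continuous_winFt hφ.one).measurable.comp (measurable_divA.comp measurable_swap)
  exact ((memLp_cft2 hf).1.comp_quasiMeasurePreserving Measure.quasiMeasurePreserving_snd).mul
    h2.aestronglyMeasurable

/-- By Tonelli, with ξ integrated first: invariance turns the inner integral into |f̂(η)|² times the
admissibility integral. This justifies the later exchange of integrals. -/
theorem memLp_spec {φ f : ℝ × ℝ → ℂ} (hφ : IsWin φ) (hf : MemLp f 2 mu2) :
    MemLp (fun p : (ℝ × ℝ) × (ℝ × ℝ) => spec φ f p.1 p.2) 2 (lam.prod mu2) := by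
  have hm := aestronglyMeasurable_spec hφ hf
  rw [memLp_two_iff_integrable_sq_norm hm]
  have hw := (memLp_two_iff_integrable_sq_norm hφ.win.1).1 hφ.win
  have e : ∀ η ξ : ℝ × ℝ, ‖spec φ f ξ η‖ ^ 2 = ‖cft2 f η‖ ^ 2 * ‖winFt φ (divA η ξ)‖ ^ 2 := by
    intro η ξ
    rw [spec, norm_mul, mul_pow]
    rfl
  have e2 : ∀ᵐ η ∂mu2, ∫ ξ, ‖spec φ f ξ η‖ ^ 2 ∂lam =
      ‖cft2 f η‖ ^ 2 * ∫ ξ, ‖winFt φ ξ‖ ^ 2 ∂lam := by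
    filter_upwards [ae_detA_ne_zero] with η hη
    simp only [e]
    rw [integral_const_mul, integral_comp_divA (P := fun ξ => ‖winFt φ ξ‖ ^ 2) hw.1 hη]
  rw [integrable_prod_iff' (by exact hm.norm.pow 2)]
  constructor
  · filter_upwards [ae_detA_ne_zero] with η hη
    simp only [e]
    exact ((measurePreserving_divA hη).integrable_comp_of_integrable hw).const_mul _
  · simp only [norm_pow, norm_norm]
    refine Integrable.congr ?_ (e2.mono fun _ h => h.symm)
    exact ((memLp_two_iff_integrable_sq_norm (memLp_cft2 hf).1).1 (memLp_cft2 hf)).mul_const _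

theorem integrable_mul_conj {X : Type*} [MeasurableSpace X] {μ : Measure X} {F G : X → ℂ}
    (hF : MemLp F 2 μ) (hG : MemLp G 2 μ) : Integrable (fun x => F x * conj (G x)) μ :=
  hF.integrable_mul hG.star

theorem integral_spec {φ ψ f g : ℝ × ℝ → ℂ} (hφ : IsWin φ) (hψ : IsWin ψ)
    (hf : MemLp f 2 mu2) (hg : MemLp g 2 mu2) :
    ∫ ξ, ∫ η, spec φ f ξ η * conj (spec ψ g ξ η) ∂mu2 ∂lam =
      (∫ ξ, winFt φ ξ * conj (winFt ψ ξ) ∂lam) * ∫ x, f x * conj (g x) ∂mu2 := by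
  have hi := integrable_mul_conj (memLp_spec hφ hf) (memLp_spec hψ hg)
  rw [integral_integral_swap hi, ← integral_cft2_mul_conj hf hg, ← integral_const_mul]
  refine integral_congr_ae ?_
  filter_upwards [ae_detA_ne_zero] with η hη
  rw [← integral_comp_divA (integrable_mul_conj hφ.win hψ.win).1 hη, ← integral_mul_const]
  refine integral_congr_ae (.of_forall fun ξ => ?_)
  simp only [spec, winFt, map_mul]
  ring

/-- Equality holds at every point: nondegenerate dilations preserve null sets, and the prefactor
vanishes when det A_ξ = 0. Measurable representatives may thus be used for joint measurability. -/
theorem cst_congr {φ φ' f f' : ℝ × ℝ → ℂ} (hφ : φ =ᵐ[mu2] φ') (hf : f =ᵐ[mu2] f') :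
    cst φ f = cst φ' f' := by
  ext ξ b
  by_cases hξ : detA ξ = 0
  · simp [cst, hξ]
  unfold cst
  congr 1
  refine integral_congr_ae ?_
  have h := (measurePreserving_applyA_sub hξ b).quasiMeasurePreserving.ae_eq_comp
    ((Measure.smul_absolutelyContinuous (c := ENNReal.ofReal |detA ξ|⁻¹)).ae_eq hφ)
  filter_upwards [hf, h] with x h1 h2
  have h2 : φ (applyA ξ (x - b)) = φ' (applyA ξ (x - b)) := h2
  simp only [atom, h1, h2]

theorem stronglyMeasurable_cst {φ f : ℝ × ℝ → ℂ} (hφ : AEStronglyMeasurable φ mu2)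
    (hf : AEStronglyMeasurable f mu2) :
    StronglyMeasurable (fun p : (ℝ × ℝ) × (ℝ × ℝ) => cst φ f p.1 p.2) := by
  obtain ⟨φ', hφ', h1⟩ := hφ
  obtain ⟨f', hf', h2⟩ := hf
  rw [cst_congr h1 h2]
  have hd : Measurable fun p : (ℝ × ℝ) × (ℝ × ℝ) => Real.sqrt |detA p.1| :=
    ((measurable_detA.comp measurable_fst).abs).sqrt
  refine hd.stronglyMeasurable.smul ?_
  refine StronglyMeasurable.integral_prod_right' (f := fun q : ((ℝ × ℝ) × (ℝ × ℝ)) × (ℝ × ℝ) =>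
    f' q.2 * conj (atom φ' q.1.1 q.1.2 q.2)) ?_
  have ha : Measurable fun q : ((ℝ × ℝ) × (ℝ × ℝ)) × (ℝ × ℝ) => applyA q.1.1 (q.2 - q.1.2) := by
    unfold applyA; fun_prop
  have he : Measurable fun q : ((ℝ × ℝ) × (ℝ × ℝ)) × (ℝ × ℝ) => expDot q.2 q.1.1 :=
    continuous_expDot.measurable.comp (by fun_prop : Measurable
      fun q : ((ℝ × ℝ) × (ℝ × ℝ)) × (ℝ × ℝ) => (q.2, q.1.1))
  exact (hf'.comp_measurable measurable_snd).mul
    (he.stronglyMeasurable.mul (hφ'.comp_measurable ha)).star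

theorem memLp_cst_prod {φ f : ℝ × ℝ → ℂ} (hφ : IsWin φ) (hf : MemLp f 2 mu2) :
    MemLp (fun p : (ℝ × ℝ) × (ℝ × ℝ) => cst φ f p.1 p.2) 2 (mu2.prod mu2) := by
  have hm := (stronglyMeasurable_cst hφ.one.1 hf.1).aestronglyMeasurable (μ := mu2.prod mu2)
  rw [memLp_two_iff_integrable_sq_norm hm, integrable_prod_iff (by exact hm.norm.pow 2)]
  constructor
  · filter_upwards [ae_detA_ne_zero] with ξ hξ
    have h := memLp_cst hφ.one hφ.two hf hξ
    exact (memLp_two_iff_integrable_sq_norm h.1).1 h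
  · have hs := memLp_spec hφ hf
    have hi := integrable_lam_iff.1
      ((memLp_two_iff_integrable_sq_norm hs.1).1 hs).integral_prod_left
    refine hi.congr ?_
    filter_upwards [ae_detA_ne_zero] with ξ hξ
    have h := integral_cst_mul_conj hφ.one hφ.two hφ.one hφ.two hf hf hξ
    simp only [Complex.mul_conj, Complex.normSq_eq_norm_sq] at h
    rw [integral_complex_ofReal, integral_complex_ofReal, Complex.real_smul,
      ← Complex.ofReal_mul] at h
    simp only [norm_pow, norm_norm, smul_eq_mul]
    exact (Complex.ofReal_injective h).symm

/-- The Parseval identity for the complex Stockwell transform. -/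
theorem integral_cst_prod {φ ψ f g : ℝ × ℝ → ℂ} (hφ : IsWin φ) (hψ : IsWin ψ)
    (hf : MemLp f 2 mu2) (hg : MemLp g 2 mu2) :
    ∫ p, cst φ f p.1 p.2 * conj (cst ψ g p.1 p.2) ∂(mu2.prod mu2) =
      (∫ ξ, winFt φ ξ * conj (winFt ψ ξ) ∂lam) * ∫ x, f x * conj (g x) ∂mu2 := by
  rw [integral_prod _ (integrable_mul_conj (memLp_cst_prod hφ hf) (memLp_cst_prod hψ hg)),
    ← integral_spec hφ hψ hf hg, integral_lam]
  refine integral_congr_ae ?_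
  filter_upwards [ae_detA_ne_zero] with ξ hξ
  exact integral_cst_mul_conj hφ.one hφ.two hψ.one hψ.two hf hg hξ

/-! ### The splitting ℍ = (1 + k)ℂ ⊕ (1 - k)ℂ -/

/-- The quaternion with the given components. -/
def quat (a b c d : ℝ) : ℍ[ℝ] := ⟨a, b, c, d⟩

@[simp] theorem re_quat (a b c d : ℝ) : (quat a b c d).re = a := rfl
@[simp] theorem imI_quat (a b c d : ℝ) : (quat a b c d).imI = b := rfl
@[simp] theorem imJ_quat (a b c d : ℝ) : (quat a b c d).imJ = c := rfl
@[simp] theorem imK_quat (a b c d : ℝ) : (quat a b c d).imK = d := rfl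

theorem expI_eq_quat (t : ℝ) : expI t = quat (Real.cos t) (Real.sin t) 0 0 := rfl
theorem expJ_eq_quat (t : ℝ) : expJ t = quat (Real.cos t) 0 (Real.sin t) 0 := rfl
theorem qj_eq_quat : qj = quat 0 0 1 0 := rfl

/-- The embedding of `ℂ` in the quaternions that sends `i` to the unit `j`. -/
def embJ : ℂ →L[ℝ] ℍ[ℝ] := LinearMap.toContinuousLinearMap
  { toFun := fun z => quat z.re 0 z.im 0
    map_add' := fun z w => by ext <;> simp
    map_smul' := fun c z => by ext <;> simp }

/-- The map `z ↦ (1 + k) z`, where `ℂ` is embedded through `j`. -/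
def embP : ℂ →L[ℝ] ℍ[ℝ] := LinearMap.toContinuousLinearMap
  { toFun := fun z => quat z.re (-z.im) z.im z.re
    map_add' := fun z w => by ext <;> (simp; try ring)
    map_smul' := fun c z => by ext <;> simp }

/-- The map `z ↦ (1 - k) z`, where `ℂ` is embedded through `j`. -/
def embM : ℂ →L[ℝ] ℍ[ℝ] := LinearMap.toContinuousLinearMap
  { toFun := fun z => quat z.re z.im z.im (-z.re)
    map_add' := fun z w => by ext <;> (simp; try ring)
    map_smul' := fun c z => by ext <;> simp }

/-- The first coordinate in the decomposition `ℍ = (1 + k) ℂ ⊕ (1 - k) ℂ`. -/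
def coordP : ℍ[ℝ] →L[ℝ] ℂ := LinearMap.toContinuousLinearMap
  { toFun := fun q => ⟨(q.re + q.imK) / 2, (q.imJ - q.imI) / 2⟩
    map_add' := fun z w => by apply Complex.ext <;> simp <;> ring
    map_smul' := fun c z => by apply Complex.ext <;> simp <;> ring }

/-- The second coordinate in the decomposition `ℍ = (1 + k) ℂ ⊕ (1 - k) ℂ`. -/
def coordM : ℍ[ℝ] →L[ℝ] ℂ := LinearMap.toContinuousLinearMap
  { toFun := fun q => ⟨(q.re - q.imK) / 2, (q.imI + q.imJ) / 2⟩
    map_add' := fun z w => by apply Complex.ext <;> simp <;> ring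
    map_smul' := fun c z => by apply Complex.ext <;> simp <;> ring }

theorem embJ_apply (z : ℂ) : embJ z = quat z.re 0 z.im 0 := rfl
theorem embP_apply (z : ℂ) : embP z = quat z.re (-z.im) z.im z.re := rfl
theorem embM_apply (z : ℂ) : embM z = quat z.re z.im z.im (-z.re) := rfl
theorem coordP_apply (q : ℍ[ℝ]) :
    coordP q = ⟨(q.re + q.imK) / 2, (q.imJ - q.imI) / 2⟩ := rfl
theorem coordM_apply (q : ℍ[ℝ]) :
    coordM q = ⟨(q.re - q.imK) / 2, (q.imI + q.imJ) / 2⟩ := rfl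

theorem embP_coordP_add_embM_coordM (q : ℍ[ℝ]) : embP (coordP q) + embM (coordM q) = q := by
  ext <;> simp [embP_apply, embM_apply, coordP_apply, coordM_apply] <;> ring

theorem coordP_emb (z w : ℂ) : coordP (embP z + embM w) = z := by
  apply Complex.ext <;> simp [embP_apply, embM_apply, coordP_apply]; ring

theorem coordM_emb (z w : ℂ) : coordM (embP z + embM w) = w := by
  apply Complex.ext <;> simp [embP_apply, embM_apply, coordM_apply]; ring

theorem emb_mul_embJ (z w v : ℂ) :
    (embP z + embM w) * embJ v = embP (z * v) + embM (w * v) := by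
  ext <;> simp [embP_apply, embM_apply, embJ_apply] <;> ring

/-- The summands are orthogonal for the scalar product, and |1 ± k|² = 2 gives the factor. -/
theorem re_emb_mul_star (z w z' w' : ℂ) :
    ((embP z + embM w) * star (embP z' + embM w')).re =
      2 * (z * conj z' + w * conj w').re := by
  simp [embP_apply, embM_apply]; ring

theorem embJ_mul (z w : ℂ) : embJ (z * w) = embJ z * embJ w := by
  ext <;> simp [embJ_apply]

theorem star_embJ (z : ℂ) : star (embJ z) = embJ (conj z) := by
  ext <;> simp [embJ_apply]

theorem expJ_eq_embJ (t : ℝ) : expJ t = embJ (Complex.exp (t * Complex.I)) := by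
  ext <;> simp [expJ_eq_quat, embJ_apply, Complex.exp_ofReal_mul_I_re, Complex.exp_ofReal_mul_I_im]

/-- Since i(1 + k) = (1 + k)(-j) and i(1 - k) = (1 - k)j, the left exponential becomes a complex
phase, of opposite sign on the two summands. -/
theorem expI_mul_emb (t : ℝ) (z w : ℂ) : expI t * (embP z + embM w) =
    embP (Complex.exp ((-t : ℝ) * Complex.I) * z) + embM (Complex.exp (t * Complex.I) * w) := by
  ext <;> simp [expI_eq_quat, embP_apply, embM_apply, Complex.exp_ofReal_mul_I_re,
    Complex.exp_ofReal_mul_I_im, -Complex.ofReal_neg] <;> ring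

/-- The reflection `(ξ₁, ξ₂) ↦ (-ξ₁, ξ₂)`. -/
def reflA (ξ : ℝ × ℝ) : ℝ × ℝ := (-ξ.1, ξ.2)

theorem measurePreserving_reflA : MeasurePreserving reflA mu2 mu2 := by
  have h : MeasurePreserving reflA volume volume :=
    (Measure.measurePreserving_neg (volume : Measure ℝ)).prod (MeasurePreserving.id _)
  exact h.smul_measure _

theorem measurableEmbedding_reflA : MeasurableEmbedding reflA :=
  ((Homeomorph.neg ℝ).prodCongr (Homeomorph.refl ℝ)).measurableEmbedding

theorem expDot_reflA (x ξ : ℝ × ℝ) : expDot (reflA x) ξ = expDot x (reflA ξ) := by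
  simp [expDot, reflA]

theorem twosided_kernel (x w : ℝ × ℝ) (q : ℍ[ℝ]) :
    expI (-(x.1 * w.1)) * q * expJ (-(x.2 * w.2)) =
      embP (expDot x (-reflA w) * coordP q) + embM (expDot x (-w) * coordM q) := by
  nth_rw 1 [← embP_coordP_add_embM_coordM q]
  rw [expI_mul_emb, expJ_eq_embJ, emb_mul_embJ]
  congr 2
  · rw [mul_right_comm, ← Complex.exp_add, expDot]
    congr 2
    simp [reflA]
    ring
  · rw [mul_right_comm, ← Complex.exp_add, expDot]
    congr 2
    simp
    ring

theorem cft_comp_reflA (h : ℝ × ℝ → ℂ) (w : ℝ × ℝ) :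
    cft (fun x => h (reflA x)) w = cft h (reflA w) := by
  rw [cft_eq_expDot, cft_eq_expDot,
    ← measurePreserving_reflA.integral_comp measurableEmbedding_reflA]
  refine integral_congr_ae (.of_forall fun x => ?_)
  simp only [expDot_reflA]
  congr 2
  ext <;> simp [reflA]

theorem integral_emb {X : Type*} [MeasurableSpace X] {μ : Measure X} {z w : X → ℂ}
    (hz : Integrable z μ) (hw : Integrable w μ) :
    ∫ x, (embP (z x) + embM (w x)) ∂μ = embP (∫ x, z x ∂μ) + embM (∫ x, w x ∂μ) := by
  rw [integral_add (embP.integrable_comp hz) (embM.integrable_comp hw),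
    embP.integral_comp_comm hz, embM.integral_comp_comm hw]

theorem qft_eq_cft {φ : ℝ × ℝ → ℍ[ℝ]} (h1 : MemLp φ 1 mu2) (w : ℝ × ℝ) :
    qft φ w = embP (cft (fun x => coordP (φ x)) (reflA w)) +
      embM (cft (fun x => coordM (φ x)) w) := by
  rw [qft, cft_eq_expDot, cft_eq_expDot]
  simp only [twosided_kernel]
  exact integral_emb
    (memLp_one_iff_integrable.1 (memLp_expDot_mul (coordP.comp_memLp' h1) _))
    (memLp_one_iff_integrable.1 (memLp_expDot_mul (coordM.comp_memLp' h1) _))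

/-! ### Rigidity of windows under the commutation hypotheses -/

theorem qj_mul_expI (t : ℝ) : expI t * qj = qj * expI (-t) := by
  ext <;> simp [expI_eq_quat, qj_eq_quat]

theorem qft_qj_mul {φ : ℝ × ℝ → ℍ[ℝ]} (h1 : MemLp φ 1 mu2) (w : ℝ × ℝ) :
    qft (fun x => qj * φ x) w = qj * qft φ (reflA w) := by
  have hi : Integrable (fun x : ℝ × ℝ =>
      expI (-(x.1 * (reflA w).1)) * φ x * expJ (-(x.2 * (reflA w).2))) mu2 := by
    simp only [twosided_kernel]
    exact (embP.integrable_comp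
      (memLp_one_iff_integrable.1 (memLp_expDot_mul (coordP.comp_memLp' h1) _))).add
      (embM.integrable_comp
        (memLp_one_iff_integrable.1 (memLp_expDot_mul (coordM.comp_memLp' h1) _)))
  have h := (ContinuousLinearMap.mul ℝ ℍ[ℝ] qj).integral_comp_comm hi
  rw [qft, qft]
  refine Eq.trans ?_ h
  refine integral_congr_ae (.of_forall fun x => ?_)
  simp only [ContinuousLinearMap.mul_apply', reflA]
  rw [← mul_assoc, qj_mul_expI, mul_assoc, mul_assoc, mul_assoc]
  simp

theorem qj_mul_injective {p q : ℍ[ℝ]} (h : qj * p = qj * q) : p = q := by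
  have hj : qj ≠ 0 := fun h => by
    have := congrArg QuaternionAlgebra.imJ h
    simp [qj_eq_quat] at this
  exact mul_left_cancel₀ hj h

theorem CommutationHyp.cft_coord {φ : ℝ × ℝ → ℍ[ℝ]} (h1 : MemLp φ 1 mu2) (h : CommutationHyp φ)
    {w : ℝ × ℝ} (hw : w.2 ≠ 0) :
    cft (fun x => coordP (φ x)) w = cft (fun x => coordM (φ x)) w ∧
      cft (fun x => coordP (φ x)) (reflA w) = cft (fun x => coordP (φ x)) w := by
  have hrr : reflA (reflA w) = w := by simp [reflA]
  have hrefl : qft φ (reflA w) = qft φ w := by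
    -- At y = 0 the hypothesis reads F(jφ) = jF(φ), whereas ij = -ji gives F(jφ)(w) = jF(φ)(`reflA`
    -- w); hence evenness in u.
    have h0 := (h w.1 w.2 0).2
    have he : expJ 0 = 1 := by ext <;> simp [expJ_eq_quat]
    rw [mul_zero, neg_zero, he, mul_one, mul_one, Prod.mk.eta, qft_qj_mul h1] at h0
    exact qj_mul_injective h0
  have hcomm : coordP (qft φ w) = coordM (qft φ w) := by
    -- This y makes e^{-jvy} = j. A quaternion commuting with j has no i or k part, which is
    -- equality of its two coordinates.
    have h0 := (h w.1 w.2 (-(Real.pi / 2) / w.2)).1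
    have he : expJ (Real.pi / 2) = qj := by ext <;> simp [expJ_eq_quat, qj_eq_quat]
    rw [mul_div_cancel₀ _ hw, neg_neg, he, Prod.mk.eta] at h0
    have hI := congrArg QuaternionAlgebra.imI h0
    have hK := congrArg QuaternionAlgebra.imK h0
    simp [qj_eq_quat] at hI hK
    rw [coordP_apply, coordM_apply]
    apply Complex.ext <;> simp <;> linarith
  have hP : coordP (qft φ w) = coordP (qft φ (reflA w)) := by rw [hrefl]
  rw [qft_eq_cft h1 w, qft_eq_cft h1 (reflA w), coordP_emb, coordP_emb, hrr] at hP
  rw [qft_eq_cft h1 w, coordP_emb, coordM_emb] at hcomm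
  exact ⟨hP.symm.trans hcomm, hP⟩

/-- The coordinates along `1` and `j` of a quaternion. -/
def coordJ : ℍ[ℝ] →L[ℝ] ℂ := coordP + coordM

theorem ae_snd_ne_zero : ∀ᵐ w ∂mu2, w.2 ≠ 0 :=
  ae_detA_ne_zero.mono fun _ h => (detA_ne_zero.1 h).2

theorem CommutationHyp.ae_coordP_eq {φ : ℝ × ℝ → ℍ[ℝ]} (h1 : MemLp φ 1 mu2) (h2 : MemLp φ 2 mu2)
    (h : CommutationHyp φ) : ∀ᵐ x ∂mu2, coordP (φ x) = coordM (φ x) := by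
  refine ae_eq_of_cft_ae_eq (coordP.comp_memLp' h1) (coordP.comp_memLp' h2)
    (coordM.comp_memLp' h1) (coordM.comp_memLp' h2) ?_
  filter_upwards [ae_snd_ne_zero] with w hw
  exact (h.cft_coord h1 hw).1

theorem CommutationHyp.ae_coordP_reflA {φ : ℝ × ℝ → ℍ[ℝ]} (h1 : MemLp φ 1 mu2)
    (h2 : MemLp φ 2 mu2) (h : CommutationHyp φ) :
    ∀ᵐ x ∂mu2, coordP (φ (reflA x)) = coordP (φ x) := by
  refine ae_eq_of_cft_ae_eq
    ((coordP.comp_memLp' h1).comp_measurePreserving measurePreserving_reflA)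
    ((coordP.comp_memLp' h2).comp_measurePreserving measurePreserving_reflA)
    (coordP.comp_memLp' h1) (coordP.comp_memLp' h2) ?_
  filter_upwards [ae_snd_ne_zero] with w hw
  exact (cft_comp_reflA _ w).trans (h.cft_coord h1 hw).2

theorem coordJ_apply (q : ℍ[ℝ]) : coordJ q = ⟨q.re, q.imJ⟩ := by
  apply Complex.ext <;> simp [coordJ, coordP_apply, coordM_apply] <;> ring

/-- A window with values in `ℝ + ℝ j` that is even in its first variable. -/
structure IsEvenWindow (φ : ℝ × ℝ → ℍ[ℝ]) : Prop where
  one : MemLp φ 1 mu2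
  two : MemLp φ 2 mu2
  ae_eq : ∀ᵐ x ∂mu2, φ x = embJ (coordJ (φ x))
  ae_even : ∀ᵐ x ∂mu2, coordJ (φ (reflA x)) = coordJ (φ x)

theorem CommutationHyp.isEvenWindow {φ : ℝ × ℝ → ℍ[ℝ]} (h1 : MemLp φ 1 mu2)
    (h2 : MemLp φ 2 mu2) (h : CommutationHyp φ) : IsEvenWindow φ where
  one := h1
  two := h2
  ae_eq := by
    filter_upwards [h.ae_coordP_eq h1 h2] with x hx
    rw [coordP_apply, coordM_apply, Complex.ext_iff] at hx
    simp only at hx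
    ext <;> simp [embJ_apply, coordJ_apply] <;> linarith [hx.1, hx.2]
  ae_even := by
    filter_upwards [h.ae_coordP_eq h1 h2, h.ae_coordP_reflA h1 h2,
      measurePreserving_reflA.quasiMeasurePreserving.ae (h.ae_coordP_eq h1 h2)] with x h3 h4 h5
    simp only [coordJ, add_apply]
    rw [← h5, ← h3, h4]

theorem cft_congr {f g : ℝ × ℝ → ℂ} (h : f =ᵐ[mu2] g) : cft f = cft g := by
  ext w
  refine integral_congr_ae ?_
  filter_upwards [h] with x hx
  rw [hx]

/-- Both coordinates of an (ℝ + ℝj)-valued function are half its value, and evenness removes the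
reflection; then (1 + k)z/2 + (1 - k)z/2 = z. -/
theorem IsEvenWindow.qft_star {φ : ℝ × ℝ → ℍ[ℝ]} (h : IsEvenWindow φ) (w : ℝ × ℝ) :
    qft (fun x => star (φ x)) w = embJ (cft (fun x => conj (coordJ (φ x))) w) := by
  have hs1 : MemLp (fun x => star (φ x)) 1 mu2 := h.one.star
  have hhalf : ∀ v : ℝ × ℝ → ℂ, ∀ w, cft (fun x => (2⁻¹ : ℂ) * v x) w = 2⁻¹ * cft v w := by
    intro v w
    rw [cft, cft, ← integral_const_mul]
    refine integral_congr_ae (.of_forall fun x => ?_)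
    simp only
    ring
  have hP : (fun x => coordP (star (φ x))) =ᵐ[mu2] fun x => 2⁻¹ * conj (coordJ (φ x)) := by
    filter_upwards [h.ae_eq] with x hx
    rw [hx]
    apply Complex.ext <;> simp [coordP_apply, coordJ_apply, embJ_apply] <;> ring
  have hM : (fun x => coordM (star (φ x))) =ᵐ[mu2] fun x => 2⁻¹ * conj (coordJ (φ x)) := by
    filter_upwards [h.ae_eq] with x hx
    rw [hx]
    apply Complex.ext <;> simp [coordM_apply, coordJ_apply, embJ_apply] <;> ring
  have he : (fun x => conj (coordJ (φ (reflA x)))) =ᵐ[mu2] fun x => conj (coordJ (φ x)) := by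
    filter_upwards [h.ae_even] with x hx
    rw [hx]
  rw [qft_eq_cft hs1, cft_congr hP, cft_congr hM, hhalf, hhalf, ← cft_comp_reflA, cft_congr he]
  ext <;> simp [embP_apply, embM_apply, embJ_apply] <;> ring

/-! ### Splitting the quaternion Stockwell transform -/

theorem stockwell_congr {φ φ' : ℝ × ℝ → ℍ[ℝ]} (hφ : φ =ᵐ[mu2] φ') (f : ℝ × ℝ → ℍ[ℝ]) :
    stockwell φ f = stockwell φ' f := by
  ext1 ξ; ext1 b
  by_cases hξ : detA ξ = 0
  · simp [stockwell, hξ]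
  unfold stockwell
  congr 1
  refine integral_congr_ae ?_
  have h := (measurePreserving_applyA_sub hξ b).quasiMeasurePreserving.ae_eq_comp
    ((Measure.smul_absolutelyContinuous (c := ENNReal.ofReal |detA ξ|⁻¹)).ae_eq hφ)
  filter_upwards [h] with x h2
  have h2 : φ (applyA ξ (x - b)) = φ' (applyA ξ (x - b)) := h2
  simp only [h2]

theorem detA_reflA (ξ : ℝ × ℝ) : |detA (reflA ξ)| = |detA ξ| := by
  simp [detA, reflA, abs_mul]

theorem IsEvenWindow.stockwell_eq {φ f : ℝ × ℝ → ℍ[ℝ]} (h : IsEvenWindow φ) (hf : MemLp f 2 mu2)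
    (ξ b : ℝ × ℝ) : stockwell φ f ξ b =
      embP (cst (fun x => coordJ (φ x)) (fun x => coordP (f x)) (reflA ξ) b) +
      embM (cst (fun x => coordJ (φ x)) (fun x => coordM (f x)) ξ b) := by
  by_cases hξ : detA ξ = 0
  · have hξ' : |detA (reflA ξ)| = 0 := by rw [detA_reflA, hξ, abs_zero]
    simp [stockwell, cst, hξ, hξ']
  have hξ' : detA (reflA ξ) ≠ 0 := by rwa [← abs_ne_zero, detA_reflA, abs_ne_zero]
  have he : (fun x => coordJ (φ (reflA x))) =ᵐ[mu2] fun x => coordJ (φ x) := h.ae_even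
  have h2 : MemLp (fun x => coordJ (φ x)) 2 mu2 := coordJ.comp_memLp' h.two
  have h2' : MemLp (fun x => coordJ (φ (reflA x))) 2 mu2 :=
    h2.comp_measurePreserving measurePreserving_reflA
  -- In the (1 + k) part the frequency is reflected, but the window still sees A_ξ(x - b). Replacing
  -- the complex window by its reflection makes the dilation match the reflected frequency.
  rw [stockwell_congr (φ' := fun x => embJ (coordJ (φ x))) h.ae_eq, ← cst_congr he (ae_eq_refl _),
    cst, cst, stockwell, detA_reflA, map_smul, map_smul, ← smul_add]
  congr 1
  rw [← integral_emb
    (z := fun x => coordP (f x) * conj (atom (fun x => coordJ (φ (reflA x))) (reflA ξ) b x))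
    (w := fun x => coordM (f x) * conj (atom (fun x => coordJ (φ x)) ξ b x))
    (integrable_mul_conj (coordP.comp_memLp' hf) (memLp_atom h2' hξ' b))
    (integrable_mul_conj (coordM.comp_memLp' hf) (memLp_atom h2 hξ b))]
  refine integral_congr_ae (.of_forall fun x => ?_)
  simp only
  have e : reflA (applyA (reflA ξ) (x - b)) = applyA ξ (x - b) := by simp [reflA, applyA]
  rw [twosided_kernel, star_embJ, emb_mul_embJ, atom, atom, map_mul (starRingEnd ℂ),
    map_mul (starRingEnd ℂ), conj_expDot, conj_expDot, e]
  congr 2 <;> ring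

/-! ### Scalar products and admissibility constants in coordinates -/

/-- The real part of a quaternion as a continuous linear map. -/
def reL : ℍ[ℝ] →L[ℝ] ℝ := LinearMap.toContinuousLinearMap
  { toFun := fun q => q.re
    map_add' := fun _ _ => rfl
    map_smul' := fun _ _ => rfl }

theorem scInner_emb {X : Type*} [MeasurableSpace X] {μ : Measure X} {z w z' w' : X → ℂ}
    (hz : MemLp z 2 μ) (hw : MemLp w 2 μ) (hz' : MemLp z' 2 μ) (hw' : MemLp w' 2 μ) :
    scInner μ (fun x => embP (z x) + embM (w x)) (fun x => embP (z' x) + embM (w' x)) =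
      2 * (∫ x, z x * conj (z' x) ∂μ + ∫ x, w x * conj (w' x) ∂μ).re := by
  have hF : MemLp (fun x => embP (z x) + embM (w x)) 2 μ :=
    (embP.comp_memLp' hz).add (embM.comp_memLp' hw)
  have hG : MemLp (fun x => embP (z' x) + embM (w' x)) 2 μ :=
    (embP.comp_memLp' hz').add (embM.comp_memLp' hw')
  have hi := hF.integrable_mul hG.star
  have h1 := reL.integral_comp_comm hi
  rw [← integral_add (integrable_mul_conj hz hz') (integrable_mul_conj hw hw')]
  have h2 := Complex.reCLM.integral_comp_comm
    ((integrable_mul_conj hz hz').add (integrable_mul_conj hw hw'))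
  refine h1.symm.trans ?_
  refine Eq.trans ?_ (congrArg (2 * ·) h2)
  rw [← integral_const_mul]
  refine integral_congr_ae (.of_forall fun x => ?_)
  exact re_emb_mul_star _ _ _ _

theorem scInner_self {X : Type*} [MeasurableSpace X] {μ : Measure X} {F : X → ℍ[ℝ]}
    (hF : MemLp F 2 μ) : scInner μ F F = ∫ x, ‖F x‖ ^ 2 ∂μ := by
  refine (reL.integral_comp_comm (hF.integrable_mul hF.star)).symm.trans ?_
  refine integral_congr_ae (.of_forall fun x => ?_)
  change (F x * star (F x)).re = _
  rw [Quaternion.self_mul_star, Quaternion.normSq_eq_norm_mul_self]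
  exact (sq _).symm

theorem norm_embJ (z : ℂ) : ‖embJ z‖ = ‖z‖ := by
  rw [← sq_eq_sq₀ (norm_nonneg _) (norm_nonneg _), sq ‖embJ z‖,
    ← Quaternion.normSq_eq_norm_mul_self, Quaternion.normSq_def', ← Complex.normSq_eq_norm_sq,
    Complex.normSq_apply]
  simp [embJ_apply, sq]

theorem IsEvenWindow.admIntegrand_eq {φ : ℝ × ℝ → ℍ[ℝ]} (h : IsEvenWindow φ) (ξ : ℝ × ℝ) :
    admIntegrand φ ξ = |detA ξ|⁻¹ • ‖winFt (fun x => coordJ (φ x)) ξ‖ ^ 2 := by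
  rw [admIntegrand, h.qft_star, norm_embJ, div_eq_inv_mul, smul_eq_mul]
  rfl

theorem IsEvenWindow.isWin {φ : ℝ × ℝ → ℍ[ℝ]} (h : IsEvenWindow φ)
    (hi : Integrable (admIntegrand φ) mu2) : IsWin (fun x => coordJ (φ x)) where
  one := coordJ.comp_memLp' h.one
  two := coordJ.comp_memLp' h.two
  win := by
    have hm := (continuous_winFt (coordJ.comp_memLp' h.one)).aestronglyMeasurable (μ := lam)
    refine (memLp_two_iff_integrable_sq_norm hm).2 (integrable_lam_iff.2 ?_)
    exact hi.congr (.of_forall h.admIntegrand_eq)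

theorem IsEvenWindow.pairIntegrand_eq {φ ψ : ℝ × ℝ → ℍ[ℝ]} (hφ : IsEvenWindow φ)
    (hψ : IsEvenWindow ψ) : pairIntegrand φ ψ = fun ξ => |detA ξ|⁻¹ •
      embJ (winFt (fun x => coordJ (φ x)) ξ * conj (winFt (fun x => coordJ (ψ x)) ξ)) := by
  ext1 ξ
  rw [pairIntegrand, hφ.qft_star, hψ.qft_star, embJ_mul, star_embJ]
  rfl

/-! ### Quaternion Parseval and Plancherel -/

section Parseval

variable {φ ψ f g : ℝ × ℝ → ℍ[ℝ]}

theorem IsEvenWindow.integrable_pairIntegrand (hφ : IsEvenWindow φ) (hψ : IsEvenWindow ψ)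
    (hφi : Integrable (admIntegrand φ) mu2) (hψi : Integrable (admIntegrand ψ) mu2) :
    Integrable (pairIntegrand φ ψ) mu2 := by
  rw [hφ.pairIntegrand_eq hψ]
  exact integrable_lam_iff.1
    (embJ.integrable_comp (integrable_mul_conj (hφ.isWin hφi).win (hψ.isWin hψi).win))

theorem IsEvenWindow.pairConst_eq (hφ : IsEvenWindow φ) (hψ : IsEvenWindow ψ)
    (hφi : Integrable (admIntegrand φ) mu2) (hψi : Integrable (admIntegrand ψ) mu2) :
    pairConst φ ψ = embJ (∫ ξ, winFt (fun x => coordJ (φ x)) ξ *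
      conj (winFt (fun x => coordJ (ψ x)) ξ) ∂lam) := by
  rw [pairConst, hφ.pairIntegrand_eq hψ, ← integral_lam]
  exact embJ.integral_comp_comm (integrable_mul_conj (hφ.isWin hφi).win (hψ.isWin hψi).win)

theorem measurePreserving_reflA_fst :
    MeasurePreserving (fun p : (ℝ × ℝ) × (ℝ × ℝ) => (reflA p.1, p.2)) (mu2.prod mu2)
      (mu2.prod mu2) :=
  measurePreserving_reflA.prod (MeasurePreserving.id _)

theorem measurableEmbedding_reflA_fst :
    MeasurableEmbedding (fun p : (ℝ × ℝ) × (ℝ × ℝ) => (reflA p.1, p.2)) :=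
  (((Homeomorph.neg ℝ).prodCongr (Homeomorph.refl ℝ)).prodCongr
    (Homeomorph.refl (ℝ × ℝ))).measurableEmbedding

theorem memLp_cst_reflA {φ f : ℝ × ℝ → ℂ} (hφ : IsWin φ) (hf : MemLp f 2 mu2) :
    MemLp (fun p : (ℝ × ℝ) × (ℝ × ℝ) => cst φ f (reflA p.1) p.2) 2 (mu2.prod mu2) :=
  (memLp_cst_prod hφ hf).comp_measurePreserving measurePreserving_reflA_fst

theorem integral_cst_reflA {φ ψ f g : ℝ × ℝ → ℂ} (hφ : IsWin φ) (hψ : IsWin ψ)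
    (hf : MemLp f 2 mu2) (hg : MemLp g 2 mu2) :
    ∫ p, cst φ f (reflA p.1) p.2 * conj (cst ψ g (reflA p.1) p.2) ∂(mu2.prod mu2) =
      (∫ ξ, winFt φ ξ * conj (winFt ψ ξ) ∂lam) * ∫ x, f x * conj (g x) ∂mu2 := by
  rw [← integral_cst_prod hφ hψ hf hg]
  exact measurePreserving_reflA_fst.integral_comp measurableEmbedding_reflA_fst
    (fun p : (ℝ × ℝ) × (ℝ × ℝ) => cst φ f p.1 p.2 * conj (cst ψ g p.1 p.2))

theorem IsEvenWindow.stockwell4_eq (h : IsEvenWindow φ) (hf : MemLp f 2 mu2) :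
    stockwell4 φ f = fun p =>
      embP (cst (fun x => coordJ (φ x)) (fun x => coordP (f x)) (reflA p.1) p.2) +
      embM (cst (fun x => coordJ (φ x)) (fun x => coordM (f x)) p.1 p.2) :=
  funext fun p => h.stockwell_eq hf p.1 p.2

theorem IsEvenWindow.memLp_stockwell4 (h : IsEvenWindow φ)
    (hi : Integrable (admIntegrand φ) mu2) (hf : MemLp f 2 mu2) :
    MemLp (stockwell4 φ f) 2 mu4 := by
  rw [h.stockwell4_eq hf, mu4_eq_prod]
  exact (embP.comp_memLp' (memLp_cst_reflA (h.isWin hi) (coordP.comp_memLp' hf))).add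
    (embM.comp_memLp' (memLp_cst_prod (h.isWin hi) (coordM.comp_memLp' hf)))

/-- The constant lies in ℝ + ℝj, so right multiplication by it scales both coordinates of f by the
same complex number, as the complex identity requires; reflecting ξ does not change the integral. -/
theorem IsEvenWindow.scInner_stockwell4 (hφ : IsEvenWindow φ) (hψ : IsEvenWindow ψ)
    (hφi : Integrable (admIntegrand φ) mu2) (hψi : Integrable (admIntegrand ψ) mu2)
    (hf : MemLp f 2 mu2) (hg : MemLp g 2 mu2) :
    scInner mu4 (stockwell4 φ f) (stockwell4 ψ g) =
      scInner mu2 (fun x => f x * pairConst φ ψ) g := by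
  have hφw := hφ.isWin hφi
  have hψw := hψ.isWin hψi
  have hfP : MemLp (fun x => coordP (f x)) 2 mu2 := coordP.comp_memLp' hf
  have hfM : MemLp (fun x => coordM (f x)) 2 mu2 := coordM.comp_memLp' hf
  have hgP : MemLp (fun x => coordP (g x)) 2 mu2 := coordP.comp_memLp' hg
  have hgM : MemLp (fun x => coordM (g x)) 2 mu2 := coordM.comp_memLp' hg
  rw [hφ.pairConst_eq hψ hφi hψi]
  set C := ∫ ξ, winFt (fun x => coordJ (φ x)) ξ * conj (winFt (fun x => coordJ (ψ x)) ξ) ∂lam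
    with hC
  have e1 : (fun x => f x * embJ C) =
      fun x => embP (coordP (f x) * C) + embM (coordM (f x) * C) := by
    ext1 x
    rw [← emb_mul_embJ, embP_coordP_add_embM_coordM]
  have e2 : g = fun x => embP (coordP (g x)) + embM (coordM (g x)) :=
    funext fun x => (embP_coordP_add_embM_coordM _).symm
  have e3 : scInner mu2 (fun x => f x * embJ C) g = scInner mu2
      (fun x => embP (coordP (f x) * C) + embM (coordM (f x) * C))
      (fun x => embP (coordP (g x)) + embM (coordM (g x))) := by rw [e1, ← e2]
  rw [e3, scInner_emb (hfP.mul_const C) (hfM.mul_const C) hgP hgM,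
    hφ.stockwell4_eq hf, hψ.stockwell4_eq hg, mu4_eq_prod,
    scInner_emb (memLp_cst_reflA hφw hfP) (memLp_cst_prod hφw hfM)
      (memLp_cst_reflA hψw hgP) (memLp_cst_prod hψw hgM),
    integral_cst_reflA hφw hψw hfP hgP, integral_cst_prod hφw hψw hfM hgM, ← hC,
    ← integral_const_mul, ← integral_const_mul]
  simp only [mul_assoc, mul_left_comm C]

theorem pairConst_self (hi : Integrable (admIntegrand φ) mu2) :
    pairConst φ φ = ((admConst φ : ℝ) : ℍ[ℝ]) := by
  have h := (algebraMapCLM ℝ ℍ[ℝ]).integral_comp_comm hi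
  refine Eq.trans ?_ h
  refine integral_congr_ae (.of_forall fun ξ => ?_)
  simp only [pairIntegrand, admIntegrand]
  rw [Quaternion.self_mul_star, Quaternion.normSq_eq_norm_mul_self, ← sq, div_eq_inv_mul]
  exact (Quaternion.coe_smul _ _).symm

theorem scInner_mul_coe {X : Type*} [MeasurableSpace X] (μ : Measure X) (F G : X → ℍ[ℝ]) (c : ℝ) :
    scInner μ (fun x => F x * (c : ℍ[ℝ])) G = c * scInner μ F G := by
  have h : ∀ x, F x * (c : ℍ[ℝ]) * star (G x) = c • (F x * star (G x)) := fun x => by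
    rw [Quaternion.mul_coe_eq_smul, smul_mul_assoc]
  simp only [scInner, qInner, h]
  rw [integral_smul, Quaternion.re_smul, smul_eq_mul]

theorem integral_norm_sq_eq_eLpNorm {X : Type*} [MeasurableSpace X] {μ : Measure X} {F : X → ℍ[ℝ]}
    (hF : MemLp F 2 μ) : ∫ x, ‖F x‖ ^ 2 ∂μ = (eLpNorm F 2 μ).toReal ^ 2 := by
  have h0 : 0 ≤ ∫ x, ‖F x‖ ^ 2 ∂μ := integral_nonneg fun x => by positivity
  rw [hF.eLpNorm_eq_integral_rpow_norm (by norm_num) (by norm_num)]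
  simp only [ENNReal.toReal_ofNat, Real.rpow_ofNat]
  rw [ENNReal.toReal_ofReal (by positivity), ← Real.rpow_natCast, ← Real.rpow_mul h0]
  norm_num

theorem IsEvenWindow.integral_norm_sq_stockwell (h : IsEvenWindow φ)
    (hi : Integrable (admIntegrand φ) mu2) (hf : MemLp f 2 mu2) :
    ∫ b, ∫ ξ, ‖stockwell φ f ξ b‖ ^ 2 ∂mu2 ∂mu2 =
      admConst φ * (eLpNorm f 2 mu2).toReal ^ 2 := by
  have hm := h.memLp_stockwell4 hi hf
  have hP := h.scInner_stockwell4 h hi hi hf hf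
  rw [scInner_self hm, pairConst_self hi, scInner_mul_coe, scInner_self hf,
    integral_norm_sq_eq_eLpNorm hf] at hP
  have hint := (memLp_two_iff_integrable_sq_norm hm.1).1 hm
  rw [mu4_eq_prod] at hint hP
  rw [← hP]
  exact (integral_prod_symm _ hint).symm

end Parseval

end QStockwell

end

theorem mainTheorem1 (φ ψ : ℝ × ℝ → ℍ[ℝ])
    (hφ : QStockwell.IsAdmissibleWindow φ) (hψ : QStockwell.IsAdmissibleWindow ψ)
    (hφc : QStockwell.CommutationHyp φ) (hψc : QStockwell.CommutationHyp ψ) :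
    Integrable (QStockwell.pairIntegrand φ ψ) QStockwell.mu2 ∧
    (∀ f g : ℝ × ℝ → ℍ[ℝ], MemLp f 2 QStockwell.mu2 → MemLp g 2 QStockwell.mu2 →
      MemLp (QStockwell.stockwell4 φ f) 2 QStockwell.mu4 ∧
      MemLp (QStockwell.stockwell4 ψ g) 2 QStockwell.mu4 ∧
      QStockwell.scInner QStockwell.mu4 (QStockwell.stockwell4 φ f) (QStockwell.stockwell4 ψ g) =
        QStockwell.scInner QStockwell.mu2 (fun x => f x * QStockwell.pairConst φ ψ) g) ∧
    (∀ f : ℝ × ℝ → ℍ[ℝ], MemLp f 2 QStockwell.mu2 →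
      ∫ b, ∫ ξ, ‖QStockwell.stockwell φ f ξ b‖ ^ 2 ∂QStockwell.mu2 ∂QStockwell.mu2 =
        QStockwell.admConst φ * (eLpNorm f 2 QStockwell.mu2).toReal ^ 2) := by
  have eφ := hφc.isEvenWindow hφ.memLp_one hφ.memLp_two
  have eψ := hψc.isEvenWindow hψ.memLp_one hψ.memLp_two
  exact ⟨eφ.integrable_pairIntegrand eψ hφ.integrable hψ.integrable,
    fun f g hf hg => ⟨eφ.memLp_stockwell4 hφ.integrable hf, eψ.memLp_stockwell4 hψ.integrable hg,
      eφ.scInner_stockwell4 eψ hφ.integrable hψ.integrable hf hg⟩,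
    fun f hf => eφ.integral_norm_sq_stockwell hφ.integrable hf⟩
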